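/- Let $\Sigma$ be a finite, totally ordered alphabet. Regular expressions are $r,s ::= \phi \mid \varepsilon \mid x \mid r+s \mid r\cdot s \mid r^*$ with $x\in\Sigma$; $\mathcal L(r)\subseteq\Sigma^*$ is the usual language of $r$ ($\mathcal L(\phi)=\emptyset$), and $d_x(r)$ is the Brzozowski derivative of $r$ by $x$. Sums are right-nested. **Canonical descendants.** Similarity $\sim$ is the least congruence with $r+r\sim r$, $r+s\sim s+r$, $r+(s+t)\sim(r+s)+t$, $\varepsilon\cdot r\sim r$, $\phi\cdot r\sim\phi$, $\phi+r\sim r$, $r+\phi\sim r$. The canonical representative $\mathrm{cnf}(r)$ is the least expression similar to $r$, where expressions are compared by size, then by head constructor or symbol, then by left components, then by right components. A descendant of $r$ is $r$ or a derivative $d_x(d)$ of a descendant $d$ of $r$; $D(r)$ is the set of all $\mathrm{cnf}(d)$, $d$ a descendant of $r$. **Equations.** Mixed expressions $\gamma,\alpha,\beta$ may contain variables $R$ besides symbols of $\Sigma$. A regular equation is $R\approx\alpha$ with $\alpha ::= r\cdot R\mid r\mid \alpha+\alpha$ ($r$ without variables); it is in normal form if $R\notin\alpha$, or $\alpha=s_1\cdot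 R_1+\dots+s_n\cdot R_n+t$ with $R_1=R$, pairwise distinct $R_i$, and $s_i,t$ without variables. Write $\gamma\simeq\gamma'$ if $\gamma$ can be transformed into $\gamma'$ by finitely many uses, in either direction, at top level or inside summands of sums, of $\gamma_1\cdot(\gamma_2+\gamma_3)\simeq\gamma_1\cdot\gamma_2+\gamma_1\cdot\gamma_3$, $\ \gamma_1\cdot(\gamma_2\cdot\gamma_3)\simeq(\gamma_1\cdot\gamma_2)\cdot\gamma_3$, $\ \gamma_1+(\gamma_2+\gamma_3)\simeq(\gamma_1+\gamma_2)+\gamma_3$, $\ \gamma_2\cdot\gamma_1+\gamma_3\cdot\gamma_1\simeq(\gamma_2+\gamma_3)\cdot\gamma_1$, $\ \gamma_1+\gamma_2\simeq\gamma_2+\gamma_1$. **Solving.** For a substitution $\psi$ and a set $\mathcal E$ of equations with distinct left-hand sides, the solving steps are: * (Arden) $\langle\psi,\{R\approx s\cdot R+\alpha\}\uplus\mathcal E\rangle\Rightarrow\langle\psi,\{R\approx s^*\cdot\alpha\}\uplus\mathcal E\rangle$ if $R\notin\alpha$ and $s$ has no variables; * (Subst) $\langle\psi,\{R\approx\alpha\}\uplus\mathcal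 E\rangle\Rightarrow\langle\psi',\mathcal E'\rangle$ if $R\notin\alpha$, where $\psi'$ consists of $R\mapsto\alpha$ and of $S\mapsto\{R\mapsto\alpha\}(\gamma)$ for all $S\mapsto\gamma$ in $\psi$, and $\mathcal E'$ contains, for each $R'\approx\alpha'$ in $\mathcal E$, one equation $R'\approx\alpha''$ with $\{R\mapsto\alpha\}(\alpha')\simeq\alpha''$. **Ambiguity.** Parse trees are $v ::= \mathrm{Eps}\mid\mathrm{Sym}\,x\mid\mathrm{Seq}\,v\,v\mid\mathrm{Inl}\,v\mid\mathrm{Inr}\,v\mid[\,]\mid v:v\mid\mathrm{Fold}\,v$, and $|v|$ is the word of symbols read off $v$ from left to right. For variable-free expressions, $\vdash v:r$ is given by: $\vdash\mathrm{Eps}:\varepsilon$; $\vdash\mathrm{Sym}\,x:x$; $\vdash\mathrm{Seq}\,v_1\,v_2:r_1\cdot r_2$ if $\vdash v_i:r_i$ for $i=1,2$; $\vdash\mathrm{Inl}\,v:r_1+r_2$ if $\vdash v:r_1$; $\vdash\mathrm{Inr}\,v:r_1+r_2$ if $\vdash v:r_2$; $\vdash[\,]:r^*$; $\vdash(v:vs):r^*$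 if $\vdash v:r$ and $\vdash vs:r^*$. (Fold is used only for unfolding equations.) The expression $r$ is unambiguous if there are no $v_1\neq v_2$ with $\vdash v_1:r$, $\vdash v_2:r$ and $|v_1|=|v_2|$. **Equations for intersection.** For regular expressions $r,s$ let $\mathcal I_{r,s}$ consist of one equation for each $(r',s')\in D(r)\times D(s)$: $R_{r',s'}\approx\phi$ if $\mathcal L(r')=\emptyset$ or $\mathcal L(s')=\emptyset$, and otherwise $$R_{r',s'}\approx\sum_{x\in\Sigma}x\cdot R_{\mathrm{cnf}(d_x(r')),\,\mathrm{cnf}(d_x(s'))}+t,$$ where $t=\varepsilon$ if $\varepsilon\in\mathcal L(r')\cap\mathcal L(s')$ and $t=\phi$ otherwise. **Theorem (Intersection).** Let $r,s$ be regular expressions. 1. (Well-definedness.) There are a set $\mathcal E$ of regular equations in normal form, obtained from $\mathcal I_{r,s}$ by replacing right-hand sides by $\simeq$-equivalent ones, and a substitution $\psi$ with $\langle\{\},\mathcal E\rangle\Rightarrow^*\langle\psi,\{\}\rangle$. 2. Whenever $\mathcal E$ is obtained from $\mathcal I_{r,s}$ by replacing right-hand sides by $\simeq$-equivalent ones (possibly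 $\mathcal E=\mathcal I_{r,s}$) and $\langle\{\},\mathcal E\rangle\Rightarrow^*\langle\psi,\{\}\rangle$, the expression $r\cap s:=\psi(R_{\mathrm{cnf}(r),\mathrm{cnf}(s)})$ is a regular expression (it contains no variables), it is unambiguous, and $\mathcal L(r\cap s)=\mathcal L(r)\cap\mathcal L(s)$. -/

import Mathlib

namespace RegEq

universe u v

/-! ### Mixed expressions, regular equations -/

/-- Expressions `γ` that mix regular expressions over `A` with regular language symbols
(variables) from `V`: a letter `Sum.inl x` is the symbol `x` of the alphabet, a letter
`Sum.inr R` is the variable `R`. -/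
abbrev Mixed (A : Type u) (V : Type v) := RegularExpression (A ⊕ V)

/-- A regular expression, regarded as a mixed expression without variables. -/
abbrev lift {A : Type u} {V : Type v} (r : RegularExpression A) : Mixed A V :=
  r.map Sum.inl

/-- The variable `R` as a mixed expression. -/
abbrev var {A : Type u} {V : Type v} (R : V) : Mixed A V :=
  RegularExpression.char (Sum.inr R)

/-- `Occurs R γ`: the variable `R` appears in `γ`. -/
def Occurs {A : Type u} {V : Type v} (R : V) : Mixed A V → Prop
  | .zero => False
  | .epsilon => False
  | .char (Sum.inl _) => False
  | .char (Sum.inr S) => S = R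
  | .plus γ₁ γ₂ => Occurs R γ₁ ∨ Occurs R γ₂
  | .comp γ₁ γ₂ => Occurs R γ₁ ∨ Occurs R γ₂
  | .star γ => Occurs R γ

open Classical in
/-- `subst R α γ` is `{R ↦ α}(γ)`: every occurrence of `R` in `γ` is replaced by `α`. -/
noncomputable def subst {A : Type u} {V : Type v} (R : V) (α : Mixed A V) :
    Mixed A V → Mixed A V
  | .zero => 0
  | .epsilon => 1
  | .char (Sum.inl x) => .char (Sum.inl x)
  | .char (Sum.inr S) => if S = R then α else var S
  | .plus γ₁ γ₂ => subst R α γ₁ + subst R α γ₂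
  | .comp γ₁ γ₂ => subst R α γ₁ * subst R α γ₂
  | .star γ => (subst R α γ).star

/-- Right-hand sides of regular equations, `α ::= r · R | r | α + α`. -/
inductive IsRhs {A : Type u} {V : Type v} : Mixed A V → Prop
  | mulVar (r : RegularExpression A) (R : V) : IsRhs (lift r * var R)
  | reg (r : RegularExpression A) : IsRhs (lift r)
  | add {α β : Mixed A V} : IsRhs α → IsRhs β → IsRhs (α + β)

/-- A family of expressions for some of the variables: `F R = some γ` says that the family holds
`γ` for `R`, and `F R = none` that `R` is not in its domain. Both a set of equations
`{R₁ ≈ α₁, …}` with distinct left-hand sides and a substitution `{R₁ ↦ γ₁, …}` are such families. -/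
abbrev Family (A : Type u) (V : Type v) := V → Option (Mixed A V)

/-- The empty set of equations, or the empty substitution. -/
def emptyFamily (A : Type u) (V : Type v) : Family A V := fun _ => none

/-- `s₁ · R₁ + (s₂ · R₂ + (… + t))`. -/
def linearSum {A : Type u} {V : Type v} (l : List (RegularExpression A × V))
    (t : RegularExpression A) : Mixed A V :=
  l.foldr (fun p γ => lift p.1 * var p.2 + γ) (lift t)

/-- The equation `R ≈ α` is in normal form: either `R` does not appear in `α`, or
`α = s₁ · R₁ + … + sₙ · Rₙ + t` with `R = R₁` and pairwise distinct `R₁, …, Rₙ`. -/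
def NormalForm {A : Type u} {V : Type v} (R : V) (α : Mixed A V) : Prop :=
  IsRhs α ∧
    (¬ Occurs R α ∨
      ∃ (s : RegularExpression A) (l : List (RegularExpression A × V)) (t : RegularExpression A),
        (R :: l.map Prod.snd).Nodup ∧ α = linearSum ((s, R) :: l) t)

/-- All equations of `E` are in normal form. -/
def InNormalForm {A : Type u} {V : Type v} (E : Family A V) : Prop :=
  ∀ R α, E R = some α → NormalForm R α

/-- The equivalence `γ₁ ≃ γ₂`: one expression can be transformed into the other by the laws
(E1) to (E5), used in either direction and below sums (E6), any number of times (E7). -/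
inductive Equivalent {A : Type u} {V : Type v} : Mixed A V → Mixed A V → Prop
  | e1 (γ₁ γ₂ γ₃) : Equivalent (γ₁ * (γ₂ + γ₃)) (γ₁ * γ₂ + γ₁ * γ₃)
  | e2 (γ₁ γ₂ γ₃) : Equivalent (γ₁ * (γ₂ * γ₃)) ((γ₁ * γ₂) * γ₃)
  | e3 (γ₁ γ₂ γ₃) : Equivalent (γ₁ + (γ₂ + γ₃)) ((γ₁ + γ₂) + γ₃)
  | e4 (γ₁ γ₂ γ₃) : Equivalent (γ₂ * γ₁ + γ₃ * γ₁) ((γ₂ + γ₃) * γ₁)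
  | e5 (γ₁ γ₂) : Equivalent (γ₁ + γ₂) (γ₂ + γ₁)
  | e6_left {γ₁ γ₂} (β) : Equivalent γ₁ γ₂ → Equivalent (γ₁ + β) (γ₂ + β)
  | e6_right {γ₁ γ₂} (β) : Equivalent γ₁ γ₂ → Equivalent (β + γ₁) (β + γ₂)
  | e7 {γ₁ γ₂ γ₃} : Equivalent γ₁ γ₂ → Equivalent γ₂ γ₃ → Equivalent γ₁ γ₃
  | refl (γ) : Equivalent γ γ
  | symm {γ₁ γ₂} : Equivalent γ₁ γ₂ → Equivalent γ₂ γ₁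

/-- `E'` arises from `E` by rewriting right-hand sides with `≃`. -/
def Rewrites {A : Type u} {V : Type v} (E E' : Family A V) : Prop :=
  ∀ R, Option.Rel Equivalent (E R) (E' R)

/-! ### Solving -/

open Classical in
/-- One solving step `⟨ψ, E⟩ ⇒ ⟨ψ', E'⟩` between configurations, which consist of the substitution
accumulated so far and the equations that are left. -/
inductive Step {A : Type u} {V : Type v} :
    Family A V × Family A V → Family A V × Family A V → Prop
  /-- (Arden) the equation `R ≈ s · R + α` with `R ∉ α` becomes `R ≈ s* · α`. -/
  | arden {ψ E : Family A V} {R : V} {s : RegularExpression A} {α : Mixed A V} :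
      E R = some (lift s * var R + α) → ¬ Occurs R α →
      Step (ψ, E) (ψ, Function.update E R (some (lift s.star * α)))
  /-- (Subst) the equation `R ≈ α` with `R ∉ α` is moved to the substitution, and `R` is replaced
  everywhere; the new right-hand sides may be rewritten with `≃`. -/
  | subst {ψ E E' : Family A V} {R : V} {α : Mixed A V} :
      E R = some α → ¬ Occurs R α →
      E' R = none →
      (∀ S, S ≠ R → Option.Rel Equivalent ((E S).map (subst R α)) (E' S)) →
      Step (ψ, E) (Function.update (fun S => (ψ S).map (RegEq.subst R α)) R (some α), E')

/-- `⟨{}, E⟩ ⇒* ⟨ψ, {}⟩`. -/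
def SolvesTo {A : Type u} {V : Type v} (E ψ : Family A V) : Prop :=
  Relation.ReflTransGen Step (emptyFamily A V, E) (ψ, emptyFamily A V)

/-! ### Parse trees and ambiguity -/

inductive ParseTree (A : Type u) : Type u
  | eps : ParseTree A
  | sym : A → ParseTree A
  | seq : ParseTree A → ParseTree A → ParseTree A
  | inl : ParseTree A → ParseTree A
  | inr : ParseTree A → ParseTree A
  | nil : ParseTree A
  | cons : ParseTree A → ParseTree A → ParseTree A
  | fold : ParseTree A → ParseTree A

/-- The word underlying a parse tree. -/
def ParseTree.flatten {A : Type u} : ParseTree A → List A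
  | .eps => []
  | .sym x => [x]
  | .seq v₁ v₂ => v₁.flatten ++ v₂.flatten
  | .inl v => v.flatten
  | .inr v => v.flatten
  | .nil => []
  | .cons v vs => v.flatten ++ vs.flatten
  | .fold v => v.flatten

/-- `Valid E v γ`: the relation `E ⊢ v : γ` between parse trees and expressions. -/
inductive Valid {A : Type u} {V : Type v} (E : Family A V) : ParseTree A → Mixed A V → Prop
  | nil (γ : Mixed A V) : Valid E .nil γ.star
  | cons {v vs : ParseTree A} {γ : Mixed A V} :
      Valid E v γ → Valid E vs γ.star → Valid E (.cons v vs) γ.star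
  | eps : Valid E .eps 1
  | sym (x : A) : Valid E (.sym x) (.char (Sum.inl x))
  | seq {v₁ v₂ : ParseTree A} {γ₁ γ₂ : Mixed A V} :
      Valid E v₁ γ₁ → Valid E v₂ γ₂ → Valid E (.seq v₁ v₂) (γ₁ * γ₂)
  | inl {v : ParseTree A} {γ₁ : Mixed A V} (γ₂ : Mixed A V) :
      Valid E v γ₁ → Valid E (.inl v) (γ₁ + γ₂)
  | inr {v : ParseTree A} (γ₁ : Mixed A V) {γ₂ : Mixed A V} :
      Valid E v γ₂ → Valid E (.inr v) (γ₁ + γ₂)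
  | fold {v : ParseTree A} {R : V} {α : Mixed A V} :
      E R = some α → Valid E v α → Valid E (.fold v) (var R)

/-- `γ` is ambiguous with respect to `E`: some word has two distinct parse trees. -/
def Ambiguous {A : Type u} {V : Type v} (E : Family A V) (γ : Mixed A V) : Prop :=
  ∃ v₁ v₂ : ParseTree A, v₁ ≠ v₂ ∧ Valid E v₁ γ ∧ Valid E v₂ γ ∧ v₁.flatten = v₂.flatten

/-- A regular expression is unambiguous (no variables, the empty set of equations). -/
def Unambiguous {A : Type u} (r : RegularExpression A) : Prop :=
  ¬ Ambiguous (emptyFamily A Empty) (lift r)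

/-! ### Similarity, canonical representatives, descendants -/

/-- Similarity: finitely many applications, at any place, of (Idempotency), (Commutativity),
(Associativity) and (Elim1) to (Elim4). -/
inductive Similar {A : Type u} : RegularExpression A → RegularExpression A → Prop
  | idem (r) : Similar (r + r) r
  | comm (r s) : Similar (r + s) (s + r)
  | assoc (r s t) : Similar (r + (s + t)) ((r + s) + t)
  | elim1 (r) : Similar (1 * r) r
  | elim2 (r) : Similar (0 * r) 0
  | elim3 (r) : Similar (0 + r) r
  | elim4 (r) : Similar (r + 0) r
  | congr_add {r r' s s'} : Similar r r' → Similar s s' → Similar (r + s) (r' + s')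
  | congr_mul {r r' s s'} : Similar r r' → Similar s s' → Similar (r * s) (r' * s')
  | congr_star {r r'} : Similar r r' → Similar r.star r'.star
  | refl (r) : Similar r r
  | symm {r s} : Similar r s → Similar s r
  | trans {r s t} : Similar r s → Similar s t → Similar r t

/-- The number of nodes of a regular expression. -/
def size {A : Type u} : RegularExpression A → ℕ
  | .zero => 1
  | .epsilon => 1
  | .char _ => 1
  | .plus r s => size r + size s + 1
  | .comp r s => size r + size s + 1
  | .star r => size r + 1

/-- The nodes of an expression in prefix order, each recorded as the size of the subexpression
below it, followed by its constructor or symbol. -/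
def code {A : Type u} : RegularExpression A → List (ℕ ×ₗ (ℕ ⊕ₗ A))
  | .zero => [toLex (1, toLex (Sum.inl 0))]
  | .epsilon => [toLex (1, toLex (Sum.inl 1))]
  | .char x => [toLex (1, toLex (Sum.inr x))]
  | .plus r s => toLex (size r + size s + 1, toLex (Sum.inl 4)) :: (code r ++ code s)
  | .comp r s => toLex (size r + size s + 1, toLex (Sum.inl 3)) :: (code r ++ code s)
  | .star r => toLex (size r + 1, toLex (Sum.inl 2)) :: code r

/-- The order on regular expressions that picks canonical representatives. Expressions are compared
by size, then by their head constructor or symbol, then by their left components, then by their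
right components. -/
def Smaller {A : Type u} [LinearOrder A] (r s : RegularExpression A) : Prop :=
  List.Shortlex (· < ·) (code r) (code s)

theorem smaller_wf (A : Type u) [LinearOrder A] [Finite A] :
    WellFounded (Smaller (A := A)) :=
  InvImage.wf code (List.Shortlex.wf
    (WellFounded.prod_lex wellFounded_lt (Sum.lex_wf wellFounded_lt wellFounded_lt)))

/-- The canonical representative of `r`: the least among all expressions similar to `r`. In it, the
elimination laws are used exhaustively, and sums are right-nested, without duplicates, and sorted
by size and first symbol. -/
noncomputable def canon {A : Type u} [LinearOrder A] [Finite A] (r : RegularExpression A) :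
    RegularExpression A :=
  (smaller_wf A).min {s | Similar s r} ⟨r, Similar.refl r⟩

theorem canon_similar {A : Type u} [LinearOrder A] [Finite A] (r : RegularExpression A) :
    Similar (canon r) r :=
  (smaller_wf A).min_mem {s | Similar s r} ⟨r, Similar.refl r⟩

theorem canon_eq_of_similar {A : Type u} [LinearOrder A] [Finite A] {r s : RegularExpression A}
    (h : Similar r s) : canon r = canon s := by
  have hs : {t | Similar t r} = {t | Similar t s} :=
    Set.ext fun t => ⟨fun ht => ht.trans h, fun ht => ht.trans h.symm⟩
  unfold canon
  congr 1

/-- The descendants of `r`: `r` itself and the Brzozowski derivatives of descendants. -/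
inductive Descendant {A : Type u} [DecidableEq A] (r : RegularExpression A) :
    RegularExpression A → Prop
  | self : Descendant r r
  | deriv {d : RegularExpression A} (x : A) : Descendant r d → Descendant r (d.deriv x)

/-- The set of canonical representatives of the descendants of `r`. -/
def Desc {A : Type u} [LinearOrder A] [Finite A] (r : RegularExpression A) :
    Set (RegularExpression A) :=
  {r' | ∃ d, Descendant r d ∧ r' = canon d}

/-! ### Intersection -/

/-- The variables `R_{r',s'}` are named by pairs of regular expressions. -/
abbrev PairVar (A : Type u) := RegularExpression A × RegularExpression A

open Classical in
/-- The right-hand side of the equation for `R_{r',s'}`: it is `φ` if `L(r')` or `L(s')` is empty,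
otherwise `∑ x, x · R_{canon (d_x r'), canon (d_x s')} + t`, where `t = ε` if both `r'` and `s'` are
nullable and `t = φ` otherwise. -/
noncomputable def interRhs {A : Type u} [LinearOrder A] [Fintype A] (p : PairVar A) :
    Mixed A (PairVar A) :=
  if p.1.matches' = 0 ∨ p.2.matches' = 0 then 0
  else
    linearSum
      (((Finset.univ : Finset A).sort (· ≤ ·)).map fun x =>
        (RegularExpression.char x, (canon (p.1.deriv x), canon (p.2.deriv x))))
      (if [] ∈ p.1.matches' ∧ [] ∈ p.2.matches' then 1 else 0)

open Classical in
/-- The equations for the intersection of `r` and `s`, one for each pair of canonical descendants. -/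
noncomputable def interEquations {A : Type u} [LinearOrder A] [Fintype A]
    (r s : RegularExpression A) : Family A (PairVar A) :=
  fun p => if p.1 ∈ Desc r ∧ p.2 ∈ Desc s then some (interRhs p) else none

end RegEq

namespace RegEq

universe u v

/-! Expressions are read as noncommutative power series over the natural numbers (`mult`). If every
star body has constant coefficient 0 (`StarProper`), the support of the series is the language
(`mem_matches'_iff`), and a coefficient at most 1 leaves room for only one parse tree of the word
(`valid_lift`). So it suffices that the solved expression has proper stars and that its series is
the 0-1 characteristic series of the intersection.

These characteristic series satisfy the equations (`mixedMult_interRhs`), and `≃` preserves series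
because its laws hold in every semiring: idempotency is not among them. Since each variable stands
behind a letter, right-hand sides are `Guarded`: a coefficient depends on the variables only at
shorter words. In an Arden step this forces the coefficient `s` of `R` to have constant coefficient
0, so that `s*` is proper and `eq_star_cauchy` determines the series of `R`. Both kinds of step
preserve `ConfigSound`, and once no equation is left no variable can remain.

For existence, Brzozowski's theorem (`SimClass.exists_finite_closed`) makes the system finite, and
`exists_steps` eliminates one variable at a time while keeping the other right-hand sides linear. -/

/-! ### Noncommutative power series with natural coefficients -/

/-- The Cauchy product of two series, by recursion on the word. -/
def cauchy {A : Type u} (f g : List A → ℕ) : List A → ℕ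
  | [] => f [] * g []
  | a :: w => f [] * g (a :: w) + cauchy (fun u => f (a :: u)) g w
termination_by w => w.length
decreasing_by simp

/-- The series with `1` at the empty word and `0` elsewhere. -/
def unitSeries {A : Type u} : List A → ℕ
  | [] => 1
  | _ :: _ => 0

/-- The approximations of the star of a series: `starApprox f n` is correct up to length `n`. -/
def starApprox {A : Type u} (f : List A → ℕ) : ℕ → List A → ℕ
  | _, [] => 1
  | 0, _ :: _ => 0
  | n + 1, a :: w => cauchy (fun u => f (a :: u)) (starApprox f n) w

/-- The star of a series; the constant coefficient of the series is ignored. -/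
def starSeries {A : Type u} (f : List A → ℕ) (w : List A) : ℕ :=
  starApprox f w.length w

section Series

variable {A : Type u}

theorem cauchy_nil (f g : List A → ℕ) : cauchy f g [] = f [] * g [] := by
  simp [cauchy]

theorem cauchy_cons (f g : List A → ℕ) (a : A) (w : List A) :
    cauchy f g (a :: w) = f [] * g (a :: w) + cauchy (fun u => f (a :: u)) g w := by
  rw [cauchy]

theorem add_cauchy (f g h : List A → ℕ) :
    cauchy (f + g) h = cauchy f h + cauchy g h := by
  funext w
  induction w generalizing f g with
  | nil => simp [cauchy_nil, add_mul]
  | cons a w ih =>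
    have := ih (fun u => f (a :: u)) (fun u => g (a :: u))
    simp only [Pi.add_def, cauchy_cons] at this ⊢
    rw [this]
    ring

theorem cauchy_add (f g h : List A → ℕ) :
    cauchy f (g + h) = cauchy f g + cauchy f h := by
  funext w
  induction w generalizing f with
  | nil => simp [cauchy_nil, mul_add]
  | cons a w ih =>
    have := ih (fun u => f (a :: u))
    simp only [Pi.add_def, cauchy_cons] at this ⊢
    rw [this]
    ring

theorem const_mul_cauchy (c : ℕ) (f g : List A → ℕ) (w : List A) :
    cauchy (fun u => c * f u) g w = c * cauchy f g w := by
  induction w generalizing f with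
  | nil => simp [cauchy_nil, mul_assoc]
  | cons a w ih => simp only [cauchy_cons, ih (fun u => f (a :: u))]; ring

theorem cauchy_assoc (f g h : List A → ℕ) :
    cauchy (cauchy f g) h = cauchy f (cauchy g h) := by
  funext w
  induction w generalizing f with
  | nil => simp [cauchy_nil, mul_assoc]
  | cons a w ih =>
    -- The left quotient of a product by `a` obeys a Leibniz rule, which lets the induction pass to
    -- the quotient of `f`.
    have h1 : (fun u => cauchy f g (a :: u)) =
        (fun u => f [] * g (a :: u)) + cauchy (fun u => f (a :: u)) g := by
      funext u
      simp [cauchy_cons]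
    rw [cauchy_cons, cauchy_cons, h1, add_cauchy, Pi.add_apply, const_mul_cauchy, ih, cauchy_nil,
      cauchy_cons]
    ring

theorem zero_cauchy (g : List A → ℕ) : cauchy 0 g = 0 := by
  funext w
  induction w with
  | nil => simp [cauchy_nil]
  | cons a w ih =>
    rw [cauchy_cons, show (fun u => (0 : List A → ℕ) (a :: u)) = 0 from rfl, ih]
    simp

theorem unit_cauchy (g : List A → ℕ) : cauchy unitSeries g = g := by
  funext w
  cases w with
  | nil => simp [cauchy_nil, unitSeries]
  | cons a w =>
    have h : (fun u => unitSeries (a :: u)) = (0 : List A → ℕ) := rfl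
    rw [cauchy_cons, h, zero_cauchy]
    simp [unitSeries]

theorem cauchy_congr_right {g g' : List A → ℕ} (f : List A → ℕ) (w : List A)
    (h : ∀ v, v.length ≤ w.length → g v = g' v) : cauchy f g w = cauchy f g' w := by
  induction w generalizing f with
  | nil => simp [cauchy_nil, h []]
  | cons a w ih =>
    rw [cauchy_cons, cauchy_cons, h (a :: w) le_rfl,
      ih _ fun v hv => h v (hv.trans (Nat.le_succ _))]

/-- Without a constant term in `f`, only proper suffixes of `w` reach the right factor. Both the
uniqueness in Arden's lemma and guardedness rest on this. -/
theorem cauchy_congr_right_of_nil {g g' f : List A → ℕ} (hf : f [] = 0) (w : List A)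
    (h : ∀ v, v.length < w.length → g v = g' v) : cauchy f g w = cauchy f g' w := by
  cases w with
  | nil => simp [cauchy_nil, hf]
  | cons a w =>
    rw [cauchy_cons, cauchy_cons, hf, zero_mul, zero_mul,
      cauchy_congr_right _ w fun v hv => h v (Nat.lt_succ_of_le hv)]

theorem cauchy_eq_sum (f g : List A → ℕ) (w : List A) :
    cauchy f g w = ∑ i ∈ Finset.range (w.length + 1), f (w.take i) * g (w.drop i) := by
  induction w generalizing f with
  | nil => simp [cauchy_nil]
  | cons a w ih =>
    rw [cauchy_cons, List.length_cons, Finset.sum_range_succ', ih, add_comm]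
    simp

theorem le_cauchy_append (f g : List A → ℕ) (u v : List A) :
    f u * g v ≤ cauchy f g (u ++ v) := by
  rw [cauchy_eq_sum]
  have h := Finset.single_le_sum (f := fun i => f ((u ++ v).take i) * g ((u ++ v).drop i))
    (s := Finset.range ((u ++ v).length + 1)) (fun _ _ => Nat.zero_le _)
    (a := u.length) (by simp)
  simpa using h

theorem cauchy_ne_zero {f g : List A → ℕ} {w : List A} :
    cauchy f g w ≠ 0 ↔ ∃ u v, f u ≠ 0 ∧ g v ≠ 0 ∧ u ++ v = w := by
  constructor
  · intro h
    rw [cauchy_eq_sum] at h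
    obtain ⟨i, -, hi⟩ := Finset.exists_ne_zero_of_sum_ne_zero h
    exact ⟨_, _, left_ne_zero_of_mul hi, right_ne_zero_of_mul hi, List.take_append_drop i w⟩
  · rintro ⟨u, v, hu, hv, rfl⟩ h
    have := le_cauchy_append f g u v
    rw [h, Nat.le_zero] at this
    exact mul_ne_zero hu hv this

/-- Two cuts of one word at different positions, each with nonzero contribution, would already add
up to at least 2. -/
theorem eq_of_cauchy_le_one {f g : List A → ℕ} {u v u' v' : List A}
    (hu : f u ≠ 0) (hv : g v ≠ 0) (hu' : f u' ≠ 0) (hv' : g v' ≠ 0)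
    (h : u ++ v = u' ++ v') (hle : cauchy f g (u ++ v) ≤ 1) :
    u = u' ∧ v = v' ∧ f u ≤ 1 ∧ g v ≤ 1 := by
  have hmul := (le_cauchy_append f g u v).trans hle
  have hfu : f u ≤ 1 := (Nat.le_mul_of_pos_right _ (Nat.pos_of_ne_zero hv)).trans hmul
  have hgv : g v ≤ 1 := (Nat.le_mul_of_pos_left _ (Nat.pos_of_ne_zero hu)).trans hmul
  have hlen : u.length = u'.length := by
    by_contra hne
    rw [cauchy_eq_sum] at hle
    have hsub : ({u.length, u'.length} : Finset ℕ) ⊆ Finset.range ((u ++ v).length + 1) := by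
      intro i hi
      have hl := congrArg List.length h
      simp at hi hl ⊢
      omega
    have h2 := (Finset.sum_le_sum_of_subset hsub).trans hle
    rw [Finset.sum_pair hne] at h2
    -- Only the term cut at `u'.length` is to be rewritten. It holds the third and fourth
    -- occurrences of `u ++ v`; after the first rewrite the fourth has become the third.
    nth_rw 3 [h] at h2
    nth_rw 3 [h] at h2
    simp only [List.take_left, List.drop_left] at h2
    have := Nat.pos_of_ne_zero (mul_ne_zero hu hv)
    have := Nat.pos_of_ne_zero (mul_ne_zero hu' hv')
    omega
  obtain ⟨h1, h2⟩ := List.append_inj h hlen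
  exact ⟨h1, h2, hfu, hgv⟩

/-- The approximations stabilize: each unfolding consumes a letter, so the bound is never exhausted
on words of length at most `n`. -/
theorem starApprox_eq {f : List A → ℕ} {n : ℕ} {w : List A} (h : w.length ≤ n) :
    starApprox f n w = starSeries f w := by
  induction n using Nat.strong_induction_on generalizing w with
  | _ n ih =>
    match n, w, h with
    | 0, [], _ => rfl
    | n + 1, [], _ => rfl
    | n + 1, a :: w, h =>
      have hw : w.length ≤ n := Nat.le_of_succ_le_succ h
      change cauchy _ _ w = cauchy _ (starApprox f w.length) w
      refine cauchy_congr_right _ w fun v hv => ?_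
      rw [ih n (Nat.lt_succ_self n) (hv.trans hw)]
      rcases hw.lt_or_eq with hlt | rfl
      · rw [ih w.length (by omega) hv]
      · rw [ih _ (Nat.lt_succ_self _) hv]

theorem starSeries_nil (f : List A → ℕ) : starSeries f [] = 1 := rfl

theorem starSeries_cons (f : List A → ℕ) (a : A) (w : List A) :
    starSeries f (a :: w) = cauchy (fun u => f (a :: u)) (starSeries f) w :=
  cauchy_congr_right _ w fun _ hv => starApprox_eq hv

theorem starSeries_eq {f : List A → ℕ} (hf : f [] = 0) :
    starSeries f = unitSeries + cauchy f (starSeries f) := by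
  funext w
  cases w with
  | nil => simp [starSeries_nil, unitSeries, cauchy_nil, hf]
  | cons a w => simp [starSeries_cons, unitSeries, cauchy_cons, hf]

/-- Arden's lemma for series. -/
theorem eq_star_cauchy {f g X : List A → ℕ} (hf : f [] = 0) (h : X = cauchy f X + g) :
    X = cauchy (starSeries f) g := by
  -- Both series solve the same equation, whose coefficient at `w` involves the solution only at
  -- shorter words.
  have hY : cauchy (starSeries f) g = cauchy f (cauchy (starSeries f) g) + g := by
    conv_lhs => rw [starSeries_eq hf, add_cauchy, unit_cauchy, cauchy_assoc, add_comm]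
  funext w
  induction hn : w.length using Nat.strong_induction_on generalizing w with
  | _ n ih =>
    subst hn
    rw [h, hY, Pi.add_apply, Pi.add_apply,
      cauchy_congr_right_of_nil hf w fun v hv => ih _ hv v rfl]

end Series

/-! ### Multiplicities -/

/-- The series of an expression, given the series of its letters. -/
def mult {A : Type u} {B : Type v} (g : B → List A → ℕ) : RegularExpression B → List A → ℕ
  | .zero => 0
  | .epsilon => unitSeries
  | .char b => g b
  | .plus r s => mult g r + mult g s
  | .comp r s => cauchy (mult g r) (mult g s)
  | .star r => starSeries (mult g r)

open Classical in
/-- The series of a letter. -/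
noncomputable def letterSeries {A : Type u} (a : A) (w : List A) : ℕ :=
  if w = [a] then 1 else 0

/-- The series of a mixed expression, given the series of its variables. -/
noncomputable def mixedMult {A : Type u} {V : Type v} (η : V → List A → ℕ) :
    Mixed A V → List A → ℕ :=
  mult (Sum.elim letterSeries η)

/-- Bodies of stars have constant coefficient zero. -/
def StarProper {A : Type u} : RegularExpression A → Prop
  | .zero => True
  | .epsilon => True
  | .char _ => True
  | .plus r s => StarProper r ∧ StarProper s
  | .comp r s => StarProper r ∧ StarProper s
  | .star r => StarProper r ∧ mult letterSeries r [] = 0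

theorem mult_map {A : Type u} {B C : Type*} (g : C → List A → ℕ) (f : B → C)
    (r : RegularExpression B) : mult g (r.map f) = mult (g ∘ f) r := by
  induction r with
  | zero => rfl
  | epsilon => rfl
  | char b => rfl
  | plus r s ihr ihs => simp only [RegularExpression.map, mult, ihr, ihs]
  | comp r s ihr ihs => simp only [RegularExpression.map, mult, ihr, ihs]
  | star r ih => simp only [RegularExpression.map, mult, ih]

theorem mixedMult_lift {A : Type u} {V : Type v} (η : V → List A → ℕ)
    (r : RegularExpression A) : mixedMult η (lift r) = mult letterSeries r := by
  rw [mixedMult, lift, mult_map, Sum.elim_comp_inl]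

/-- Natural coefficients cannot cancel, so supports add and multiply like languages. For a star, `L*
= 1 + L · L*` is unfolded; properness makes the first factor nonempty, so induction on the length of
the word applies to the rest. -/
theorem mem_matches'_iff {A : Type u} {r : RegularExpression A} (hr : StarProper r)
    (w : List A) : w ∈ r.matches' ↔ mult letterSeries r w ≠ 0 := by
  induction r generalizing w with
  | zero => simp [mult, Language.notMem_zero]
  | epsilon =>
    change w ∈ (1 : Language A) ↔ unitSeries w ≠ 0
    rw [Language.mem_one]
    cases w <;> simp [unitSeries]
  | char a =>
    change w ∈ ({[a]} : Set (List A)) ↔ letterSeries a w ≠ 0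
    simp [letterSeries]
  | plus r s ihr ihs =>
    change w ∈ r.matches' + s.matches' ↔ mult letterSeries r w + mult letterSeries s w ≠ 0
    rw [Language.mem_add, ihr hr.1, ihs hr.2]
    omega
  | comp r s ihr ihs =>
    change w ∈ r.matches' * s.matches' ↔ cauchy _ _ w ≠ 0
    rw [Language.mem_mul, cauchy_ne_zero]
    simp only [ihr hr.1, ihs hr.2, exists_and_left]
  | star r ih =>
    change w ∈ KStar.kstar r.matches' ↔ starSeries _ w ≠ 0
    induction hn : w.length using Nat.strong_induction_on generalizing w with
    | _ n ihn =>
      subst hn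
      rw [← Language.one_add_self_mul_kstar_eq_kstar, Language.mem_add, Language.mem_one,
        Language.mem_mul, starSeries_eq hr.2]
      have key : cauchy (mult letterSeries r) (starSeries (mult letterSeries r)) w ≠ 0 ↔
          ∃ u ∈ r.matches', ∃ v ∈ KStar.kstar r.matches', u ++ v = w := by
        rw [cauchy_ne_zero]
        refine exists_congr fun u => ?_
        rw [ih hr.1]
        constructor
        · rintro ⟨v, hu, hv, rfl⟩
          refine ⟨hu, v, (ihn _ ?_ _ rfl).2 hv, rfl⟩
          have : u ≠ [] := by rintro rfl; exact hu hr.2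
          have := List.length_pos_of_ne_nil this
          simp; omega
        · rintro ⟨hu, v, hv, rfl⟩
          refine ⟨v, hu, (ihn _ ?_ _ rfl).1 hv, rfl⟩
          have : u ≠ [] := by rintro rfl; exact hu hr.2
          have := List.length_pos_of_ne_nil this
          simp; omega
      rw [← key]
      cases w <;> simp [unitSeries]

/-! ### Parse trees and coefficients -/

theorem valid_zero {A : Type u} {V : Type v} {E : Family A V} {v : ParseTree A} :
    ¬ Valid E v 0 := by
  intro h
  generalize hγ : (0 : Mixed A V) = γ at h
  cases h <;> cases hγ

theorem valid_one {A : Type u} {V : Type v} {E : Family A V} {v : ParseTree A}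
    (h : Valid E v 1) : v = .eps := by
  generalize hγ : (1 : Mixed A V) = γ at h
  cases h <;> first | rfl | cases hγ

theorem valid_letter {A : Type u} {V : Type v} {E : Family A V} {v : ParseTree A} {x : A}
    (h : Valid E v (.char (Sum.inl x))) : v = .sym x := by
  generalize hγ : (RegularExpression.char (Sum.inl x) : Mixed A V) = γ at h
  cases h <;> first | (cases hγ; rfl) | cases hγ

theorem valid_add {A : Type u} {V : Type v} {E : Family A V} {v : ParseTree A} {γ δ : Mixed A V}
    (h : Valid E v (γ + δ)) :
    (∃ v', v = .inl v' ∧ Valid E v' γ) ∨ ∃ v', v = .inr v' ∧ Valid E v' δ := by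
  generalize hγ : γ + δ = γ' at h
  cases h with
  | inl _ h => cases hγ; exact .inl ⟨_, rfl, h⟩
  | inr _ h => cases hγ; exact .inr ⟨_, rfl, h⟩
  | _ => cases hγ

theorem valid_mul {A : Type u} {V : Type v} {E : Family A V} {v : ParseTree A} {γ δ : Mixed A V}
    (h : Valid E v (γ * δ)) :
    ∃ v₁ v₂, v = .seq v₁ v₂ ∧ Valid E v₁ γ ∧ Valid E v₂ δ := by
  generalize hγ : γ * δ = γ' at h
  cases h with
  | seq h₁ h₂ => cases hγ; exact ⟨_, _, rfl, h₁, h₂⟩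
  | _ => cases hγ

theorem valid_star {A : Type u} {V : Type v} {E : Family A V} {v : ParseTree A} {γ : Mixed A V}
    (h : Valid E v γ.star) :
    v = .nil ∨ ∃ v₁ v₂, v = .cons v₁ v₂ ∧ Valid E v₁ γ ∧ Valid E v₂ γ.star := by
  generalize hγ : γ.star = γ' at h
  cases h with
  | nil => exact .inl rfl
  | cons h₁ h₂ => cases hγ; exact .inr ⟨_, _, rfl, h₁, h₂⟩
  | _ => cases hγ

/-- This is the part of "coefficients count parse trees" that unambiguity needs. Both conclusions
share one induction, since excluding a second tree requires knowing that each tree contributes at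
least 1; the first is used with `v₁ = v₂`. -/
theorem valid_lift {A : Type u} {V : Type v} {E : Family A V} {r : RegularExpression A}
    (hr : StarProper r) {v₁ v₂ : ParseTree A} (h₁ : Valid E v₁ (lift r))
    (h₂ : Valid E v₂ (lift r)) (h : v₁.flatten = v₂.flatten) :
    mult letterSeries r v₁.flatten ≠ 0 ∧ (mult letterSeries r v₁.flatten ≤ 1 → v₁ = v₂) := by
  induction r generalizing v₁ v₂ with
  | zero => exact absurd h₁ valid_zero
  | epsilon =>
    rw [valid_one h₁, valid_one h₂]
    exact ⟨one_ne_zero, fun _ => rfl⟩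
  | char a =>
    rw [valid_letter h₁, valid_letter h₂]
    exact ⟨by simp [mult, letterSeries, ParseTree.flatten], fun _ => rfl⟩
  | plus r s ihr ihs =>
    simp only [mult, Pi.add_apply]
    rcases valid_add h₁ with ⟨u₁, rfl, k₁⟩ | ⟨u₁, rfl, k₁⟩ <;>
      rcases valid_add h₂ with ⟨u₂, rfl, k₂⟩ | ⟨u₂, rfl, k₂⟩ <;>
      simp only [ParseTree.flatten] at h ⊢
    · obtain ⟨i, j⟩ := ihr hr.1 k₁ k₂ h
      exact ⟨by omega, fun hle => congrArg _ (j (by omega))⟩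
    -- Trees from different summands make both coefficients nonzero, so the sum exceeds 1.
    · obtain ⟨i, -⟩ := ihr hr.1 k₁ k₁ rfl
      obtain ⟨j, -⟩ := ihs hr.2 k₂ k₂ rfl
      rw [← h] at j
      omega
    · obtain ⟨i, -⟩ := ihs hr.2 k₁ k₁ rfl
      obtain ⟨j, -⟩ := ihr hr.1 k₂ k₂ rfl
      rw [← h] at j
      omega
    · obtain ⟨i, j⟩ := ihs hr.2 k₁ k₂ h
      exact ⟨by omega, fun hle => congrArg _ (j (by omega))⟩
  | comp r s ihr ihs =>
    obtain ⟨u₁, w₁, rfl, k₁, l₁⟩ := valid_mul h₁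
    obtain ⟨u₂, w₂, rfl, k₂, l₂⟩ := valid_mul h₂
    simp only [ParseTree.flatten, mult] at h ⊢
    have i₁ := (ihr hr.1 k₁ k₁ rfl).1
    have i₂ := (ihr hr.1 k₂ k₂ rfl).1
    have j₁ := (ihs hr.2 l₁ l₁ rfl).1
    have j₂ := (ihs hr.2 l₂ l₂ rfl).1
    refine ⟨cauchy_ne_zero.2 ⟨_, _, i₁, j₁, rfl⟩, fun hle => ?_⟩
    obtain ⟨e₁, e₂, f₁, f₂⟩ := eq_of_cauchy_le_one i₁ j₁ i₂ j₂ h hle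
    rw [(ihr hr.1 k₁ k₂ e₁).2 f₁, (ihs hr.2 l₁ l₂ e₂).2 f₂]
  | star r ih =>
    -- A tree of the body with empty word would make its constant coefficient nonzero. Hence the
    -- tail of a list of iterations has a shorter word.
    have hpos : ∀ {v}, Valid E v (lift r) → 0 < v.flatten.length := fun {v} hv => by
      refine List.length_pos_of_ne_nil fun h0 => (ih hr.1 hv hv rfl).1 ?_
      rw [h0, hr.2]
    induction hn : v₁.flatten.length using Nat.strong_induction_on generalizing v₁ v₂ with
    | _ n ihn =>
      subst hn
      simp only [mult] at ihn ⊢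
      rw [starSeries_eq hr.2, Pi.add_apply]
      rcases valid_star h₁ with rfl | ⟨u₁, w₁, rfl, k₁, l₁⟩ <;>
        rcases valid_star h₂ with rfl | ⟨u₂, w₂, rfl, k₂, l₂⟩ <;>
        simp only [ParseTree.flatten] at h ihn ⊢
      · exact ⟨by simp [unitSeries], by simp⟩
      · have := hpos k₂
        have := congrArg List.length h
        simp only [List.length_append, List.length_nil] at this
        omega
      · have := hpos k₁
        have := congrArg List.length h
        simp only [List.length_append, List.length_nil] at this
        omega
      · have p₁ := hpos k₁
        have p₂ := hpos k₂
        have hl := congrArg List.length h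
        simp only [List.length_append] at hl ihn
        have i₁ := (ih hr.1 k₁ k₁ rfl).1
        have i₂ := (ih hr.1 k₂ k₂ rfl).1
        have j₁ := (ihn _ (by omega) l₁ l₁ rfl rfl).1
        have j₂ := (ihn _ (by omega) l₂ l₂ rfl rfl).1
        have hne := cauchy_ne_zero.2 ⟨_, _, i₁, j₁, rfl⟩
        refine ⟨by omega, fun hle => ?_⟩
        obtain ⟨e₁, e₂, f₁, f₂⟩ := eq_of_cauchy_le_one i₁ j₁ i₂ j₂ h (by omega)
        rw [(ih hr.1 k₁ k₂ e₁).2 f₁, (ihn _ (by omega) l₁ l₂ e₂ rfl).2 f₂]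

theorem unambiguous_of_mult_le_one {A : Type u} {r : RegularExpression A} (hr : StarProper r)
    (h : ∀ w, mult letterSeries r w ≤ 1) : Unambiguous r := by
  rintro ⟨v₁, v₂, hne, h₁, h₂, heq⟩
  exact hne ((valid_lift hr h₁ h₂ heq).2 (h _))

/-! ### Mixed expressions -/

section Mixed

variable {A : Type u} {V : Type v}

theorem not_occurs_lift (R : V) (r : RegularExpression A) : ¬ Occurs R (lift r) := by
  induction r with
  | zero => exact id
  | epsilon => exact id
  | char a => exact id
  | plus r s ihr ihs => exact not_or.2 ⟨ihr, ihs⟩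
  | comp r s ihr ihs => exact not_or.2 ⟨ihr, ihs⟩
  | star r ih => exact ih

theorem exists_eq_lift {γ : Mixed A V} (h : ∀ R, ¬ Occurs R γ) : ∃ r, γ = lift r := by
  induction γ with
  | zero => exact ⟨0, rfl⟩
  | epsilon => exact ⟨1, rfl⟩
  | char b =>
    cases b with
    | inl x => exact ⟨.char x, rfl⟩
    | inr S => exact absurd rfl (h S)
  | plus γ δ ihγ ihδ =>
    obtain ⟨r, rfl⟩ := ihγ fun R hR => h R (.inl hR)
    obtain ⟨s, rfl⟩ := ihδ fun R hR => h R (.inr hR)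
    exact ⟨r + s, rfl⟩
  | comp γ δ ihγ ihδ =>
    obtain ⟨r, rfl⟩ := ihγ fun R hR => h R (.inl hR)
    obtain ⟨s, rfl⟩ := ihδ fun R hR => h R (.inr hR)
    exact ⟨r * s, rfl⟩
  | star γ ih =>
    obtain ⟨r, rfl⟩ := ih h
    exact ⟨r.star, rfl⟩

theorem subst_eq_self {R : V} {α γ : Mixed A V} (h : ¬ Occurs R γ) : subst R α γ = γ := by
  induction γ with
  | zero => rfl
  | epsilon => rfl
  | char b =>
    cases b with
    | inl x => rfl
    | inr S => exact if_neg h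
  | plus γ δ ihγ ihδ =>
    exact congrArg₂ _ (ihγ fun hR => h (.inl hR)) (ihδ fun hR => h (.inr hR))
  | comp γ δ ihγ ihδ =>
    exact congrArg₂ _ (ihγ fun hR => h (.inl hR)) (ihδ fun hR => h (.inr hR))
  | star γ ih => exact congrArg _ (ih h)

theorem occurs_subst {R S : V} {α γ : Mixed A V} (h : Occurs S (subst R α γ)) :
    Occurs S γ ∧ S ≠ R ∨ Occurs S α := by
  induction γ with
  | zero => exact h.elim
  | epsilon => exact h.elim
  | char b =>
    cases b with
    | inl x => exact h.elim
    | inr T =>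
      by_cases hT : T = R
      · right
        rwa [subst, if_pos hT] at h
      · rw [subst, if_neg hT] at h
        exact .inl ⟨h, fun hS => hT (Eq.trans h hS)⟩
  | plus γ δ ihγ ihδ =>
    rcases h with h | h
    · exact (ihγ h).imp_left fun h => ⟨.inl h.1, h.2⟩
    · exact (ihδ h).imp_left fun h => ⟨.inr h.1, h.2⟩
  | comp γ δ ihγ ihδ =>
    rcases h with h | h
    · exact (ihγ h).imp_left fun h => ⟨.inl h.1, h.2⟩
    · exact (ihδ h).imp_left fun h => ⟨.inr h.1, h.2⟩
  | star γ ih => exact ih h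

-- Substitution acts semantically as an update of the assignment; if `α` already has the series
-- assigned to `R`, nothing changes.
open Classical in
theorem mixedMult_subst (η : V → List A → ℕ) (R : V) (α γ : Mixed A V) :
    mixedMult η (subst R α γ) = mixedMult (Function.update η R (mixedMult η α)) γ := by
  induction γ with
  | zero => rfl
  | epsilon => rfl
  | char b =>
    cases b with
    | inl x => rfl
    | inr T =>
      by_cases hT : T = R
      · subst hT
        simp [subst, mixedMult, mult]
      · simp [subst, mixedMult, mult, hT]
  | plus γ δ ihγ ihδ => exact congrArg₂ (· + ·) ihγ ihδ
  | comp γ δ ihγ ihδ => exact congrArg₂ cauchy ihγ ihδ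
  | star γ ih => exact congrArg starSeries ih

theorem mixedMult_congr {η η' : V → List A → ℕ} {γ : Mixed A V}
    (h : ∀ R, Occurs R γ → η R = η' R) : mixedMult η γ = mixedMult η' γ := by
  induction γ with
  | zero => rfl
  | epsilon => rfl
  | char b =>
    cases b with
    | inl x => rfl
    | inr S => exact h S rfl
  | plus γ δ ihγ ihδ =>
    exact congrArg₂ (· + ·) (ihγ fun R hR => h R (.inl hR)) (ihδ fun R hR => h R (.inr hR))
  | comp γ δ ihγ ihδ =>
    exact congrArg₂ cauchy (ihγ fun R hR => h R (.inl hR)) (ihδ fun R hR => h R (.inr hR))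
  | star γ ih => exact congrArg starSeries (ih h)

theorem mixedMult_add (η : V → List A → ℕ) (γ δ : Mixed A V) :
    mixedMult η (γ + δ) = mixedMult η γ + mixedMult η δ := rfl

theorem mixedMult_mul (η : V → List A → ℕ) (γ δ : Mixed A V) :
    mixedMult η (γ * δ) = cauchy (mixedMult η γ) (mixedMult η δ) := rfl

theorem mixedMult_var (η : V → List A → ℕ) (R : V) : mixedMult η (var R : Mixed A V) = η R := rfl

/-! ### Invariants: proper stars and guardedness -/

/-- Bodies of stars have no variables and constant coefficient zero. -/
def MixedStarProper : Mixed A V → Prop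
  | .zero => True
  | .epsilon => True
  | .char _ => True
  | .plus γ δ => MixedStarProper γ ∧ MixedStarProper δ
  | .comp γ δ => MixedStarProper γ ∧ MixedStarProper δ
  | .star γ => (∀ R, ¬ Occurs R γ) ∧ MixedStarProper γ ∧ mixedMult 0 γ [] = 0

theorem mixedStarProper_lift {r : RegularExpression A} :
    MixedStarProper (lift r : Mixed A V) ↔ StarProper r := by
  induction r with
  | zero => exact Iff.rfl
  | epsilon => exact Iff.rfl
  | char a => exact Iff.rfl
  | plus r s ihr ihs => exact and_congr ihr ihs
  | comp r s ihr ihs => exact and_congr ihr ihs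
  | star r ih =>
    change (_ ∧ MixedStarProper (lift r) ∧ mixedMult 0 (lift r) [] = 0) ↔
      (StarProper r ∧ mult letterSeries r [] = 0)
    rw [ih, mixedMult_lift, and_iff_right fun R => not_occurs_lift R r]

theorem MixedStarProper.subst {R : V} {α γ : Mixed A V} (hα : MixedStarProper α)
    (hγ : MixedStarProper γ) : MixedStarProper (subst R α γ) := by
  induction γ with
  | zero => trivial
  | epsilon => trivial
  | char b =>
    cases b with
    | inl x => trivial
    | inr S =>
      rw [RegEq.subst]
      split_ifs
      · exact hα
      · trivial
  | plus γ δ ihγ ihδ => exact ⟨ihγ hγ.1, ihδ hγ.2⟩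
  | comp γ δ ihγ ihδ => exact ⟨ihγ hγ.1, ihδ hγ.2⟩
  -- Star bodies contain no variables, so substitution leaves them untouched.
  | star γ ih => rwa [subst_eq_self (show ¬ Occurs R γ.star from hγ.1 R)]

/-- The coefficient at a word depends on the variables only through coefficients at
shorter words. -/
def Guarded (γ : Mixed A V) : Prop :=
  ∀ (w : List A) (η η' : V → List A → ℕ),
    (∀ R v, v.length < w.length → η R v = η' R v) → mixedMult η γ w = mixedMult η' γ w

theorem Guarded.subst {R : V} {α γ : Mixed A V} (hα : Guarded α) (hγ : Guarded γ) :
    Guarded (subst R α γ) := by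
  classical
  intro w η η' h
  rw [mixedMult_subst, mixedMult_subst]
  refine hγ w _ _ fun S v hv => ?_
  by_cases hS : S = R
  · subst hS
    rw [Function.update_self, Function.update_self]
    exact hα v _ _ fun T u hu => h T u (hu.trans hv)
  · rw [Function.update_of_ne hS, Function.update_of_ne hS, h S v hv]

theorem Equivalent.mixedMult_eq {γ δ : Mixed A V} (h : Equivalent γ δ) (η : V → List A → ℕ) :
    mixedMult η γ = mixedMult η δ := by
  induction h with
  | e1 => simp only [mixedMult_add, mixedMult_mul, cauchy_add]
  | e2 => simp only [mixedMult_mul, cauchy_assoc]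
  | e3 => simp only [mixedMult_add, add_assoc]
  | e4 => simp only [mixedMult_add, mixedMult_mul, add_cauchy]
  | e5 => simp only [mixedMult_add, add_comm]
  | e6_left β _ ih => rw [mixedMult_add, mixedMult_add, ih]
  | e6_right β _ ih => rw [mixedMult_add, mixedMult_add, ih]
  | e7 _ _ ih₁ ih₂ => exact ih₁.trans ih₂
  | refl => rfl
  | symm _ ih => exact ih.symm

theorem Equivalent.occurs_iff {γ δ : Mixed A V} (h : Equivalent γ δ) (R : V) :
    Occurs R γ ↔ Occurs R δ := by
  have hadd : ∀ γ δ : Mixed A V, Occurs R (γ + δ) ↔ Occurs R γ ∨ Occurs R δ := fun _ _ => Iff.rfl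
  have hmul : ∀ γ δ : Mixed A V, Occurs R (γ * δ) ↔ Occurs R γ ∨ Occurs R δ := fun _ _ => Iff.rfl
  induction h with
  | refl => rfl
  | e7 _ _ ih₁ ih₂ => exact ih₁.trans ih₂
  | symm _ ih => exact ih.symm
  | _ => simp only [hadd, hmul] ; tauto

theorem Equivalent.mixedStarProper_iff {γ δ : Mixed A V} (h : Equivalent γ δ) :
    MixedStarProper γ ↔ MixedStarProper δ := by
  have hadd : ∀ γ δ : Mixed A V,
    MixedStarProper (γ + δ) ↔ MixedStarProper γ ∧ MixedStarProper δ := fun _ _ => Iff.rfl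
  have hmul : ∀ γ δ : Mixed A V,
    MixedStarProper (γ * δ) ↔ MixedStarProper γ ∧ MixedStarProper δ := fun _ _ => Iff.rfl
  induction h with
  | refl => rfl
  | e7 _ _ ih₁ ih₂ => exact ih₁.trans ih₂
  | symm _ ih => exact ih.symm
  | _ => simp only [hadd, hmul] ; tauto

theorem Equivalent.guarded {γ δ : Mixed A V} (h : Equivalent γ δ) (hγ : Guarded γ) :
    Guarded δ := by
  intro w η η' hη
  rw [← h.mixedMult_eq, ← h.mixedMult_eq]
  exact hγ w η η' hη

/-! ### Solving preserves solutions -/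

/-- The side conditions that solving maintains for an expression of a configuration:
it has the series `f` under `η`, and its variables satisfy `P`. -/
structure Sound (η : V → List A → ℕ) (P : V → Prop) (f : List A → ℕ) (γ : Mixed A V) : Prop where
  mult_eq : mixedMult η γ = f
  proper : MixedStarProper γ
  vars : ∀ R, Occurs R γ → P R

theorem Sound.equivalent {η : V → List A → ℕ} {P : V → Prop} {f : List A → ℕ} {γ δ : Mixed A V}
    (hγ : Sound η P f γ) (h : Equivalent γ δ) : Sound η P f δ where
  mult_eq := by rw [← h.mixedMult_eq, hγ.mult_eq]
  proper := h.mixedStarProper_iff.1 hγ.proper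
  vars R hR := hγ.vars R ((h.occurs_iff R).2 hR)

theorem Sound.subst {η : V → List A → ℕ} {P Q : V → Prop} {R : V} {f : List A → ℕ}
    {α γ : Mixed A V} (hα : Sound η P (η R) α) (hR : ¬ Occurs R α) (hγ : Sound η P f γ)
    (hPQ : ∀ S, S ≠ R → P S → Q S) : Sound η Q f (subst R α γ) where
  mult_eq := by
    classical
    rw [mixedMult_subst, hα.mult_eq, Function.update_eq_self, hγ.mult_eq]
  proper := hα.proper.subst hγ.proper
  vars S hS := by
    rcases occurs_subst hS with ⟨h, hne⟩ | h
    · exact hPQ S hne (hγ.vars S h)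
    · exact hPQ S (by rintro rfl; exact hR h) (hα.vars S h)

/-- Arden's rule maintains soundness and guardedness. -/
theorem arden_sound {η : V → List A → ℕ} {P : V → Prop} {R : V} {s : RegularExpression A}
    {α : Mixed A V} (hR : ¬ Occurs R α) (h : Sound η P (η R) (lift s * var R + α))
    (hg : Guarded (lift s * var R + α)) :
    Sound η P (η R) (lift s.star * α) ∧ Guarded (lift s.star * α) := by
  classical
  have heval : ∀ θ : V → List A → ℕ, mixedMult θ (lift s * var R + α) =
      cauchy (mult letterSeries s) (θ R) + mixedMult θ α := fun θ => by
    rw [mixedMult_add, mixedMult_mul, mixedMult_lift, mixedMult_var]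
  have hupd : ∀ (θ : V → List A → ℕ) f, mixedMult (Function.update θ R f) α = mixedMult θ α :=
    fun θ f => mixedMult_congr fun S hS =>
      Function.update_of_ne (by rintro rfl; exact hR hS) _ _
  -- At the empty word guardedness has no premise to check: assigning `R` the series 0 or 1 must
  -- give the same constant coefficient, and the two values differ by that of `s`.
  have hs : mult letterSeries s [] = 0 := by
    have := hg [] 0 (Function.update 0 R unitSeries) (by simp)
    simpa [heval, hupd, cauchy_nil, unitSeries] using this
  have hp : MixedStarProper (lift s : Mixed A V) := h.proper.1.1
  -- Assigning 0 to `R` removes the term `s · R` and does not affect `α`.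
  have hgα : Guarded α := by
    intro w θ θ' hθ
    have := hg w (Function.update θ R 0) (Function.update θ' R 0) fun S v hv => by
      by_cases hS : S = R
      · subst hS; simp
      · simp [Function.update_of_ne hS, hθ S v hv]
    simpa [heval, hupd] using this
  refine ⟨⟨?_, ⟨?_, h.proper.2⟩, ?_⟩, ?_⟩
  · rw [mixedMult_mul, mixedMult_lift]
    exact (eq_star_cauchy hs (by rw [← heval, h.mult_eq])).symm
  · exact mixedStarProper_lift.2 ⟨mixedStarProper_lift.1 hp, hs⟩
  · rintro S (hS | hS)
    · exact absurd hS (not_occurs_lift S s.star)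
    · exact h.vars S (.inr hS)
  · intro w θ θ' hθ
    rw [mixedMult_mul, mixedMult_mul, mixedMult_lift, mixedMult_lift]
    exact cauchy_congr_right _ w fun v hv =>
      hgα v _ _ fun S u hu => hθ S u (hu.trans_le hv)

/-- The invariant of solving. -/
structure ConfigSound (η : V → List A → ℕ) (c : Family A V × Family A V) : Prop where
  left : ∀ R γ, c.1 R = some γ → Sound η (fun S => c.2 S ≠ none) (η R) γ
  right : ∀ R γ, c.2 R = some γ → Sound η (fun S => c.2 S ≠ none) (η R) γ ∧ Guarded γ

theorem Step.configSound {η : V → List A → ℕ} {c c' : Family A V × Family A V} (h : Step c c')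
    (hc : ConfigSound η c) : ConfigSound η c' := by
  classical
  cases h with
  | @arden ψ E R s α hE hR =>
    have hdom : (fun S => Function.update E R (some (lift s.star * α)) S ≠ none) =
        fun S => E S ≠ none := by
      funext S
      by_cases hS : S = R
      · subst hS; simp [hE]
      · simp [Function.update_of_ne hS]
    constructor
    · intro S γ hS
      dsimp only at hS
      simp only [hdom]
      exact hc.left S γ hS
    · intro S γ hS
      dsimp only at hS
      simp only [hdom]
      by_cases hSR : S = R
      · subst hSR
        rw [Function.update_self, Option.some_inj] at hS
        subst hS
        exact arden_sound hR (hc.right S _ hE).1 (hc.right S _ hE).2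
      · rw [Function.update_of_ne hSR] at hS
        exact hc.right S γ hS
  | @subst ψ E E' R α hE hR hE' hrel =>
    have hdom : ∀ S, S ≠ R → E S ≠ none → E' S ≠ none := by
      intro S hS hne
      have := hrel S hS
      intro h0
      rw [h0] at this
      cases hES : E S with
      | none => exact hne hES
      | some γ => rw [hES] at this; cases this
    obtain ⟨hα, hg⟩ := hc.right R α hE
    constructor
    · intro S γ hS
      dsimp only at hS
      by_cases hSR : S = R
      · subst hSR
        rw [Function.update_self, Option.some_inj] at hS
        subst hS
        -- Substituting `α` into itself is the identity; it serves only to pass to the smaller set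
        -- of admissible variables.
        have := hα.subst (Q := fun S => E' S ≠ none) hR hα hdom
        rwa [subst_eq_self hR] at this
      · rw [Function.update_of_ne hSR] at hS
        obtain ⟨δ, hδ, rfl⟩ := Option.map_eq_some_iff.1 hS
        exact hα.subst hR (hc.left S δ hδ) hdom
    · intro S γ hS
      dsimp only at hS
      have hSR : S ≠ R := by
        rintro rfl
        rw [hE'] at hS
        cases hS
      have := hrel S hSR
      rw [hS] at this
      cases hES : E S with
      | none => rw [hES] at this; cases this
      | some δ =>
        rw [hES] at this
        cases this with
        | some heq =>
          obtain ⟨h₁, h₂⟩ := hc.right S δ hES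
          exact ⟨(hα.subst hR h₁ hdom).equivalent heq, heq.guarded (hg.subst h₂)⟩

theorem Step.mem_domain {c c' : Family A V × Family A V} (h : Step c c') {S : V}
    (hS : c.1 S ≠ none ∨ c.2 S ≠ none) : c'.1 S ≠ none ∨ c'.2 S ≠ none := by
  classical
  cases h with
  | @arden ψ E R s α hE hR =>
    by_cases hSR : S = R
    · subst hSR; simp
    · simpa [Function.update_of_ne hSR] using hS
  | @subst ψ E E' R α hE hR hE' hrel =>
    by_cases hSR : S = R
    · subst hSR; simp
    · have := hrel S hSR
      simp only [Function.update_of_ne hSR]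
      rcases hS with hS | hS
      · exact .inl (by simpa using hS)
      · right
        intro h0
        change E' S = none at h0
        rw [h0] at this
        cases hES : E S with
        | none => exact hS hES
        | some γ => rw [hES] at this; cases this

/-- Solving sound equations yields expressions without variables that have the
intended series. -/
theorem SolvesTo.exists_lift {η : V → List A → ℕ} {E ψ : Family A V} (h : SolvesTo E ψ)
    (hE : ∀ R γ, E R = some γ → Sound η (fun S => E S ≠ none) (η R) γ ∧ Guarded γ)
    {R : V} (hR : E R ≠ none) :
    ∃ e, ψ R = some (lift e) ∧ StarProper e ∧ mult letterSeries e = η R := by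
  have key : ConfigSound η (ψ, emptyFamily A V) ∧
      ((ψ, emptyFamily A V).1 R ≠ none ∨ (ψ, emptyFamily A V).2 R ≠ none) := by
    -- The motive is an implication, so the invariant travels forward from the initial configuration
    -- to the last one.
    refine Relation.ReflTransGen.head_induction_on
      (motive := fun c _ => ConfigSound η c ∧ (c.1 R ≠ none ∨ c.2 R ≠ none) →
        ConfigSound η (ψ, emptyFamily A V) ∧
        ((ψ, emptyFamily A V).1 R ≠ none ∨ (ψ, emptyFamily A V).2 R ≠ none)) h id
      (fun hs _ ih hc => ih ⟨hs.configSound hc.1, hs.mem_domain hc.2⟩) ?_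
    exact ⟨⟨fun _ _ h => (Option.some_ne_none _ h.symm).elim, hE⟩, .inr hR⟩
  obtain ⟨hs, hd⟩ := key
  cases hψ : ψ R with
  | none => simp [hψ, emptyFamily] at hd
  | some γ =>
    have hγ := hs.left R γ hψ
    -- Any remaining variable would need an equation in the empty family.
    obtain ⟨e, rfl⟩ := exists_eq_lift fun S hS => hγ.vars S hS rfl
    exact ⟨e, rfl, mixedStarProper_lift.1 hγ.proper, by rw [← hγ.mult_eq, mixedMult_lift]⟩

end Mixed

/-! ### Similarity and derivatives -/

section Similarity

variable {A : Type u}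

theorem Similar.matches'_eq {r s : RegularExpression A} (h : Similar r s) :
    r.matches' = s.matches' := by
  induction h with
  | idem => simp
  | comm => simp only [RegularExpression.matches'_add, add_comm]
  | assoc => simp only [RegularExpression.matches'_add, add_assoc]
  | elim1 => simp
  | elim2 => simp
  | elim3 => simp
  | elim4 => simp
  | congr_add _ _ ih₁ ih₂ => simp only [RegularExpression.matches'_add, ih₁, ih₂]
  | congr_mul _ _ ih₁ ih₂ => simp only [RegularExpression.matches'_mul, ih₁, ih₂]
  | congr_star _ ih => simp only [RegularExpression.matches'_star, ih]
  | refl => rfl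
  | symm _ ih => exact ih.symm
  | trans _ _ ih₁ ih₂ => exact ih₁.trans ih₂

theorem Similar.matchEpsilon_eq {r s : RegularExpression A} (h : Similar r s) :
    r.matchEpsilon = s.matchEpsilon := by
  classical
  have key : ∀ t : RegularExpression A, t.matchEpsilon = t.rmatch [] := fun _ => rfl
  rw [key, key, Bool.eq_iff_iff, RegularExpression.rmatch_iff_matches',
    RegularExpression.rmatch_iff_matches', h.matches'_eq]

variable [DecidableEq A]

theorem mem_matches'_deriv {r : RegularExpression A} {a : A} {w : List A} :
    w ∈ (r.deriv a).matches' ↔ a :: w ∈ r.matches' := by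
  rw [← RegularExpression.rmatch_iff_matches', ← RegularExpression.rmatch_iff_matches']
  rfl

theorem deriv_mul (r s : RegularExpression A) (x : A) :
    (r * s).deriv x =
      if r.matchEpsilon then r.deriv x * s + s.deriv x else r.deriv x * s := rfl

/-- The derivative of a product branches on nullability, which similarity preserves because it
preserves languages. -/
theorem Similar.deriv {r s : RegularExpression A} (h : Similar r s) (x : A) :
    Similar (r.deriv x) (s.deriv x) := by
  induction h with
  | idem r => exact .idem _
  | comm => exact .comm _ _
  | assoc => exact .assoc _ _ _
  | elim1 r => exact ((Similar.elim2 r).congr_add (.refl _)).trans (.elim3 _)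
  | elim2 r => exact .elim2 r
  | elim3 r => exact .elim3 _
  | elim4 r => exact .elim4 _
  | congr_add _ _ ih₁ ih₂ => exact ih₁.congr_add ih₂
  | congr_mul h₁ h₂ ih₁ ih₂ =>
    rw [deriv_mul, deriv_mul, h₁.matchEpsilon_eq]
    split_ifs
    · exact (ih₁.congr_mul h₂).congr_add ih₂
    · exact ih₁.congr_mul h₂
  | congr_star h ih => exact ih.congr_mul h.congr_star
  | refl => exact .refl _
  | symm _ ih => exact ih.symm
  | trans _ _ ih₁ ih₂ => exact ih₁.trans ih₂

end Similarity

/-- Regular expressions up to similarity. -/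
def similarSetoid (A : Type u) : Setoid (RegularExpression A) :=
  ⟨Similar, Similar.refl, Similar.symm, Similar.trans⟩

/-- Similarity classes. -/
abbrev SimClass (A : Type u) := Quotient (similarSetoid A)

namespace SimClass

variable {A : Type u}

/-- The class of an expression. -/
abbrev mk (r : RegularExpression A) : SimClass A := Quotient.mk (similarSetoid A) r

instance : Max (SimClass A) :=
  ⟨Quotient.map₂ (· + ·) fun _ _ h₁ _ _ h₂ => Similar.congr_add h₁ h₂⟩

instance : SemilatticeSup (SimClass A) :=
  SemilatticeSup.mk'
    (by rintro ⟨r⟩ ⟨s⟩; exact Quotient.sound (.comm r s))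
    (by rintro ⟨r⟩ ⟨s⟩ ⟨t⟩; exact Quotient.sound (Similar.assoc r s t).symm)
    (by rintro ⟨r⟩; exact Quotient.sound (.idem r))

/-- Concatenation on the right by an expression. -/
def mulRight (s : RegularExpression A) : SimClass A → SimClass A :=
  Quotient.map (· * s) fun _ _ h => Similar.congr_mul h (.refl s)

theorem mulRight_mk (r s : RegularExpression A) : mulRight s (mk r) = mk (r * s) := rfl

variable [DecidableEq A]

/-- The derivative of a similarity class. -/
def deriv (x : A) : SimClass A → SimClass A :=
  Quotient.map (fun r => r.deriv x) fun _ _ h => Similar.deriv h x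

theorem deriv_mk (x : A) (r : RegularExpression A) : deriv x (mk r) = mk (r.deriv x) := rfl

theorem deriv_sup (x : A) (p q : SimClass A) : deriv x (p ⊔ q) = deriv x p ⊔ deriv x q := by
  obtain ⟨r, rfl⟩ := Quotient.exists_rep p
  obtain ⟨s, rfl⟩ := Quotient.exists_rep q
  rfl

/-- A set of similarity classes is closed under derivatives. -/
def Closed (F : Set (SimClass A)) : Prop := ∀ p ∈ F, ∀ x, deriv x p ∈ F

theorem mem_supClosure_deriv {F G : Set (SimClass A)} {x : A}
    (h : ∀ p ∈ F, deriv x p ∈ supClosure G) {p : SimClass A} (hp : p ∈ supClosure F) :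
    deriv x p ∈ supClosure G := by
  have hsub : supClosure F ⊆ {p | deriv x p ∈ supClosure G} :=
    supClosure_min h fun a ha b hb => by
      change deriv x (a ⊔ b) ∈ supClosure G
      rw [deriv_sup]
      exact supClosed_supClosure ha hb
  exact hsub hp

theorem deriv_mulRight (x : A) (r s : RegularExpression A) :
    deriv x (mulRight s (mk r)) = mulRight s (deriv x (mk r)) ∨
      deriv x (mulRight s (mk r)) = mulRight s (deriv x (mk r)) ⊔ deriv x (mk s) := by
  rw [mulRight_mk, deriv_mk, deriv_mul]
  split_ifs
  · exact .inr rfl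
  · exact .inl rfl

/-- Brzozowski's theorem: up to similarity, an expression has finitely many descendants. -/
theorem exists_finite_closed (r : RegularExpression A) :
    ∃ F : Set (SimClass A), F.Finite ∧ mk r ∈ F ∧ Closed F := by
  induction r with
  | zero =>
    refine ⟨{mk 0}, Set.finite_singleton _, rfl, ?_⟩
    rintro p rfl x
    rfl
  | epsilon =>
    refine ⟨{mk 1, mk 0}, Set.toFinite _, .inl rfl, ?_⟩
    rintro p (rfl | rfl) x <;> exact .inr rfl
  | char a =>
    refine ⟨{mk (.char a), mk 1, mk 0}, Set.toFinite _, .inl rfl, ?_⟩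
    rintro p (rfl | rfl | rfl) x
    · right
      rw [deriv_mk, RegularExpression.deriv]
      split_ifs
      · exact .inl rfl
      · exact .inr rfl
    · exact .inr (.inr rfl)
    · exact .inr (.inr rfl)
  | plus r s ihr ihs =>
    obtain ⟨F, hF, hr, hFc⟩ := ihr
    obtain ⟨G, hG, hs, hGc⟩ := ihs
    refine ⟨Set.image2 (· ⊔ ·) F G, hF.image2 _ hG, ⟨_, hr, _, hs, rfl⟩, ?_⟩
    rintro _ ⟨p, hp, q, hq, rfl⟩ x
    exact ⟨_, hFc p hp x, _, hGc q hq x, (deriv_sup x p q).symm⟩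
  | comp r s ihr ihs =>
    obtain ⟨F, hF, hr, hFc⟩ := ihr
    obtain ⟨G, hG, hs, hGc⟩ := ihs
    -- Descendants of a product are joins of products `p · s` and descendants of `s`. In a
    -- semilattice finitely many elements have only finitely many joins.
    refine ⟨supClosure (mulRight s '' F ∪ G), ((hF.image _).union hG).supClosure,
      subset_supClosure (.inl ⟨_, hr, rfl⟩), fun p hp x => mem_supClosure_deriv ?_ hp⟩
    rintro _ (⟨p, hp, rfl⟩ | hq)
    · obtain ⟨p, rfl⟩ := Quotient.exists_rep p
      have h₁ : mulRight s (deriv x (mk p)) ∈ supClosure (mulRight s '' F ∪ G) :=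
        subset_supClosure (.inl ⟨_, hFc _ hp x, rfl⟩)
      rcases deriv_mulRight x p s with h | h
      · rw [h]
        exact h₁
      · rw [h]
        exact supClosed_supClosure h₁ (subset_supClosure (.inr (hGc _ hs x)))
    · exact subset_supClosure (.inr (hGc _ hq x))
  | star r ih =>
    obtain ⟨F, hF, hr, hFc⟩ := ih
    have hstar : ∀ x, deriv x (mk r.star) ∈ mulRight r.star '' F := fun x =>
      ⟨_, hFc _ hr x, rfl⟩
    -- The class of the star is added by hand; its derivatives already have the form `p · r*`.
    refine ⟨insert (mk r.star) (supClosure (mulRight r.star '' F)),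
      ((hF.image _).supClosure).insert _, .inl rfl, ?_⟩
    rintro p (rfl | hp) x
    · exact .inr (subset_supClosure (hstar x))
    · right
      refine mem_supClosure_deriv ?_ hp
      rintro _ ⟨p, hp, rfl⟩
      obtain ⟨p, rfl⟩ := Quotient.exists_rep p
      have h₁ : mulRight r.star (deriv x (mk p)) ∈ supClosure (mulRight r.star '' F) :=
        subset_supClosure ⟨_, hFc _ hp x, rfl⟩
      rcases deriv_mulRight x p r.star with h | h
      · rw [h]
        exact h₁
      · rw [h]
        exact supClosed_supClosure h₁ (subset_supClosure (hstar x))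

end SimClass

/-! ### Canonical descendants: finiteness and closure under derivatives -/

section Descendants

variable {A : Type u} [LinearOrder A] [Finite A]

theorem finite_desc (r : RegularExpression A) : (Desc r).Finite := by
  obtain ⟨F, hF, hr, hFc⟩ := SimClass.exists_finite_closed r
  let c : SimClass A → RegularExpression A :=
    Quotient.lift canon fun _ _ h => canon_eq_of_similar h
  refine (hF.image c).subset ?_
  rintro _ ⟨d, hd, rfl⟩
  refine ⟨SimClass.mk d, ?_, rfl⟩
  induction hd with
  | self => exact hr
  | deriv x _ ih => exact hFc _ ih x

theorem canon_mem_desc (r : RegularExpression A) : canon r ∈ Desc r := ⟨r, .self, rfl⟩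

/-- Derivatives respect similarity, so canonizing before differentiating is harmless. This gives
every variable on a right-hand side an equation of its own. -/
theorem canon_deriv_mem_desc {r p : RegularExpression A} (hp : p ∈ Desc r) (x : A) :
    canon (p.deriv x) ∈ Desc r := by
  obtain ⟨d, hd, rfl⟩ := hp
  exact ⟨_, .deriv x hd, canon_eq_of_similar ((canon_similar d).deriv x)⟩

theorem matches'_canon (r : RegularExpression A) : (canon r).matches' = r.matches' :=
  (canon_similar r).matches'_eq

end Descendants

/-! ### Linear sums -/

section LinearSum

variable {A : Type u} {V : Type v}

theorem occurs_linearSum {R : V} {l : List (RegularExpression A × V)} {t : RegularExpression A} :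
    Occurs R (linearSum l t) ↔ R ∈ l.map Prod.snd := by
  induction l with
  | nil => exact iff_of_false (not_occurs_lift R t) List.not_mem_nil
  | cons p l ih =>
    change ((Occurs R (lift p.1) ∨ p.2 = R) ∨ Occurs R (linearSum l t)) ↔ _
    rw [ih, or_iff_right (not_occurs_lift R p.1)]
    simp [eq_comm]

theorem isRhs_linearSum (l : List (RegularExpression A × V)) (t : RegularExpression A) :
    IsRhs (linearSum l t) := by
  induction l with
  | nil => exact .reg t
  | cons p l ih => exact .add (.mulVar p.1 p.2) ih

theorem mixedMult_linearSum (η : V → List A → ℕ) (l : List (RegularExpression A × V))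
    (t : RegularExpression A) :
    mixedMult η (linearSum l t) =
      (l.map fun p => cauchy (mult letterSeries p.1) (η p.2)).sum + mult letterSeries t := by
  induction l with
  | nil => exact (mixedMult_lift η t).trans (zero_add _).symm
  | cons p l ih =>
    change mixedMult η (lift p.1 * var p.2 + linearSum l t) = _
    rw [mixedMult_add, mixedMult_mul, mixedMult_lift, mixedMult_var, ih]
    simp [add_assoc]

theorem mixedStarProper_linearSum {l : List (RegularExpression A × V)} {t : RegularExpression A}
    (hl : ∀ p ∈ l, StarProper p.1) (ht : StarProper t) : MixedStarProper (linearSum l t) := by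
  induction l with
  | nil => exact mixedStarProper_lift.2 ht
  | cons p l ih =>
    exact ⟨⟨mixedStarProper_lift.2 (hl p List.mem_cons_self), trivial⟩,
      ih fun q hq => hl q (List.mem_cons_of_mem _ hq)⟩

theorem guarded_linearSum {l : List (RegularExpression A × V)} (t : RegularExpression A)
    (hl : ∀ p ∈ l, mult letterSeries p.1 [] = 0) : Guarded (linearSum l t) := by
  intro w η η' h
  rw [mixedMult_linearSum, mixedMult_linearSum, Pi.add_apply, Pi.add_apply]
  congr 1
  induction l with
  | nil => rfl
  | cons p l ih =>
    simp only [List.map_cons, List.sum_cons, Pi.add_apply]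
    rw [ih fun q hq => hl q (List.mem_cons_of_mem _ hq),
      cauchy_congr_right_of_nil (hl p List.mem_cons_self) w fun v hv => h p.2 v hv]

end LinearSum

/-! ### The equations for intersection -/

section Intersection

variable {A : Type u}

open Classical in
/-- The characteristic series of the intersection of the languages of two expressions. -/
noncomputable def interSeries (p : PairVar A) (w : List A) : ℕ :=
  if w ∈ p.1.matches' ∧ w ∈ p.2.matches' then 1 else 0

theorem cauchy_letterSeries [DecidableEq A] (x : A) (f : List A → ℕ) :
    cauchy (letterSeries x) f [] = 0 ∧
      ∀ y w, cauchy (letterSeries x) f (y :: w) = if y = x then f w else 0 := by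
  refine ⟨by simp [cauchy_nil, letterSeries], fun y w => ?_⟩
  rw [cauchy_cons]
  by_cases h : y = x
  · have : (fun u => letterSeries x (y :: u)) = unitSeries := by
      funext u
      cases u <;> simp [letterSeries, unitSeries, h]
    rw [this, unit_cauchy]
    simp [letterSeries, h]
  · have : (fun u => letterSeries x (y :: u)) = 0 := by
      funext u
      simp [letterSeries, h]
    rw [this, zero_cauchy]
    simp [letterSeries, h]

theorem starProper_ite (c : Prop) [Decidable c] :
    StarProper (if c then 1 else 0 : RegularExpression A) := by
  split_ifs <;> trivial

theorem Rewrites.ne_none_iff {V : Type v} {E E' : Family A V} (h : Rewrites E E') (R : V) :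
    E R ≠ none ↔ E' R ≠ none := by
  have := h R
  cases hE : E R <;> cases hE' : E' R <;> rw [hE, hE'] at this <;>
    first | exact iff_of_true (Option.some_ne_none _) (Option.some_ne_none _) | cases this

variable [LinearOrder A] [Fintype A]

/-- At `a :: w` only the summand of the letter `a` survives, and it tests `w` against both
derivatives; at the empty word only the constant term counts. -/
theorem mixedMult_interRhs (p : PairVar A) :
    mixedMult interSeries (interRhs p) = interSeries p := by
  classical
  funext w
  unfold interRhs
  by_cases h : p.1.matches' = 0 ∨ p.2.matches' = 0
  · rw [if_pos h]
    have : ¬ (w ∈ p.1.matches' ∧ w ∈ p.2.matches') := by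
      rintro ⟨h₁, h₂⟩
      rcases h with h | h
      · rw [h] at h₁
        exact Language.notMem_zero w h₁
      · rw [h] at h₂
        exact Language.notMem_zero w h₂
    rw [interSeries, if_neg this]
    rfl
  · rw [if_neg h, mixedMult_linearSum, List.map_map, Pi.add_apply, Function.comp_def]
    have hsum : ((((Finset.univ : Finset A).sort (· ≤ ·)).map fun x =>
        cauchy (mult letterSeries (.char x))
          (interSeries (canon (p.1.deriv x), canon (p.2.deriv x)))).sum) =
        ∑ x : A, cauchy (letterSeries x)
          (interSeries (canon (p.1.deriv x), canon (p.2.deriv x))) := by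
      rw [← List.sum_toFinset _ (Finset.sort_nodup _ _), Finset.sort_toFinset]
      rfl
    rw [hsum, Finset.sum_apply]
    cases w with
    | nil =>
      rw [Finset.sum_eq_zero fun x _ => (cauchy_letterSeries x _).1, zero_add, interSeries]
      split_ifs <;> rfl
    | cons a w =>
      simp only [(cauchy_letterSeries _ _).2, Finset.sum_ite_eq, Finset.mem_univ, if_true]
      have h0 : ∀ c : Prop, ∀ [Decidable c],
          mult letterSeries (if c then 1 else 0 : RegularExpression A) (a :: w) = 0 := by
        intro c _
        split_ifs <;> rfl
      rw [h0, add_zero]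
      simp only [interSeries, matches'_canon, mem_matches'_deriv]
      congr

/-- The right-hand side `φ` is the empty linear sum, so the two cases of the definition need no
separate treatment later. -/
theorem interRhs_eq_linearSum (p : PairVar A) :
    ∃ l t, interRhs p = linearSum l t ∧ StarProper t ∧
      ∀ q ∈ l, ∃ x, q = (.char x, (canon (p.1.deriv x), canon (p.2.deriv x))) := by
  classical
  unfold interRhs
  by_cases h : p.1.matches' = 0 ∨ p.2.matches' = 0
  · rw [if_pos h]
    exact ⟨[], 0, rfl, trivial, by simp⟩
  · rw [if_neg h]
    refine ⟨_, _, rfl, starProper_ite _, fun q hq => ?_⟩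
    obtain ⟨x, -, rfl⟩ := List.mem_map.1 hq
    exact ⟨x, rfl⟩

theorem interEquations_ne_none {r s : RegularExpression A} {p : PairVar A} :
    interEquations r s p ≠ none ↔ p.1 ∈ Desc r ∧ p.2 ∈ Desc s := by
  classical
  simp [interEquations]

theorem interEquations_eq_some {r s : RegularExpression A} {p : PairVar A}
    {γ : Mixed A (PairVar A)} (h : interEquations r s p = some γ) :
    γ = interRhs p ∧ p.1 ∈ Desc r ∧ p.2 ∈ Desc s := by
  have hp := interEquations_ne_none.1 (by rw [h]; exact Option.some_ne_none γ)
  rw [interEquations, if_pos hp] at h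
  exact ⟨(Option.some_inj.1 h).symm, hp⟩

theorem interEquations_sound {r s : RegularExpression A} {p : PairVar A}
    {γ : Mixed A (PairVar A)} (h : interEquations r s p = some γ) :
    Sound interSeries (fun q => interEquations r s q ≠ none) (interSeries p) γ ∧ Guarded γ := by
  obtain ⟨rfl, h₁, h₂⟩ := interEquations_eq_some h
  have hm := mixedMult_interRhs p
  obtain ⟨l, t, heq, ht, hl⟩ := interRhs_eq_linearSum p
  rw [heq] at hm ⊢
  refine ⟨⟨hm, mixedStarProper_linearSum (fun q hq => ?_) ht, fun q hq => ?_⟩,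
    guarded_linearSum t fun q hq => ?_⟩
  · obtain ⟨x, rfl⟩ := hl q hq
    trivial
  · obtain ⟨q', hq', rfl⟩ := List.mem_map.1 (occurs_linearSum.1 hq)
    obtain ⟨x, rfl⟩ := hl q' hq'
    exact interEquations_ne_none.2 ⟨canon_deriv_mem_desc h₁ x, canon_deriv_mem_desc h₂ x⟩
  · obtain ⟨x, rfl⟩ := hl q hq
    simp [mult, letterSeries]

theorem intersection_correct {r s : RegularExpression A} {E ψ : Family A (PairVar A)}
    (hE : Rewrites (interEquations r s) E) (hψ : SolvesTo E ψ) :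
    ∃ e : RegularExpression A, ψ (canon r, canon s) = some (lift e) ∧ Unambiguous e ∧
      e.matches' = r.matches' ⊓ s.matches' := by
  have hsound : ∀ p γ, E p = some γ →
      Sound interSeries (fun q => E q ≠ none) (interSeries p) γ ∧ Guarded γ := by
    intro p γ hγ
    have hrel := hE p
    rw [hγ] at hrel
    simp only [← hE.ne_none_iff]
    cases hδ : interEquations r s p with
    | none => rw [hδ] at hrel; cases hrel
    | some δ =>
      rw [hδ] at hrel
      cases hrel with
      | some heq =>
        obtain ⟨h₁, h₂⟩ := interEquations_sound hδ
        exact ⟨h₁.equivalent heq, heq.guarded h₂⟩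
  obtain ⟨e, he, hp, hm⟩ := hψ.exists_lift hsound (R := (canon r, canon s))
    ((hE.ne_none_iff _).1 (interEquations_ne_none.2 ⟨canon_mem_desc r, canon_mem_desc s⟩))
  refine ⟨e, he, unambiguous_of_mult_le_one hp fun w => ?_, ?_⟩
  · rw [hm, interSeries]
    split_ifs <;> simp
  · ext w
    rw [mem_matches'_iff hp, hm]
    simp only [interSeries, matches'_canon]
    change _ ↔ w ∈ r.matches' ∧ w ∈ s.matches'
    split_ifs with h <;> simp [h]

end Intersection

/-! ### Solvability -/

section Solvability

variable {A : Type u} {V : Type v}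

theorem Equivalent.add_left_comm (α β γ : Mixed A V) :
    Equivalent (α + (β + γ)) (β + (α + γ)) :=
  (Equivalent.e3 _ _ _).e7 ((Equivalent.e6_left _ (.e5 _ _)).e7 (Equivalent.e3 _ _ _).symm)

theorem equivalent_linearSum_of_perm {l l' : List (RegularExpression A × V)}
    (t : RegularExpression A) (h : l.Perm l') :
    Equivalent (linearSum l t) (linearSum l' t) := by
  induction h with
  | nil => exact .refl _
  | cons p _ ih => exact .e6_right _ ih
  | swap p q l => exact .add_left_comm _ _ _
  | trans _ _ ih₁ ih₂ => exact ih₁.e7 ih₂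

theorem equivalent_linearSum_merge (s s' t : RegularExpression A) (R : V)
    (l : List (RegularExpression A × V)) :
    Equivalent (linearSum ((s, R) :: (s', R) :: l) t) (linearSum ((s + s', R) :: l) t) :=
  (Equivalent.e3 _ _ _).e7 (Equivalent.e6_left _ (.e4 (var R) (lift s) (lift s')))

theorem exists_perm_cons {l : List (RegularExpression A × V)} {R : V}
    (h : R ∈ l.map Prod.snd) : ∃ s l', l.Perm ((s, R) :: l') := by
  obtain ⟨⟨s, _⟩, hs, rfl⟩ := List.mem_map.1 h
  obtain ⟨l₁, l₂, rfl⟩ := List.append_of_mem hs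
  exact ⟨s, l₁ ++ l₂, List.perm_middle⟩

/-- A repeated variable is moved next to its other occurrence, and the two terms merge by right
distributivity. -/
theorem exists_nodup_linearSum (l : List (RegularExpression A × V)) (t : RegularExpression A) :
    ∃ l', (l'.map Prod.snd).Nodup ∧ Equivalent (linearSum l t) (linearSum l' t) := by
  induction l with
  | nil => exact ⟨[], List.nodup_nil, .refl _⟩
  | cons p l ih =>
    obtain ⟨s, R⟩ := p
    obtain ⟨l', hnd, heq⟩ := ih
    by_cases hR : R ∈ l'.map Prod.snd
    · obtain ⟨s', l'', hperm⟩ := exists_perm_cons hR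
      refine ⟨(s + s', R) :: l'', (hperm.map Prod.snd).nodup_iff.1 hnd, ?_⟩
      exact (Equivalent.e6_right _ heq).e7
        ((equivalent_linearSum_of_perm t (hperm.cons (s, R))).e7
          (equivalent_linearSum_merge s s' t R l''))
    · exact ⟨(s, R) :: l', List.nodup_cons.2 ⟨hR, hnd⟩, .e6_right _ heq⟩

theorem exists_normal_linearSum (R : V) (l : List (RegularExpression A × V))
    (t : RegularExpression A) :
    ∃ l', Equivalent (linearSum l t) (linearSum l' t) ∧ NormalForm R (linearSum l' t) := by
  obtain ⟨l', hnd, heq⟩ := exists_nodup_linearSum l t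
  by_cases hR : R ∈ l'.map Prod.snd
  · obtain ⟨s, l'', hperm⟩ := exists_perm_cons hR
    exact ⟨(s, R) :: l'', heq.e7 (equivalent_linearSum_of_perm t hperm), isRhs_linearSum _ _,
      .inr ⟨s, l'', t, (hperm.map Prod.snd).nodup_iff.1 hnd, rfl⟩⟩
  · exact ⟨l', heq, isRhs_linearSum _ _, .inl fun h => hR (occurs_linearSum.1 h)⟩

/-- `γ` can be rewritten into a linear sum. -/
def Linearizable (γ : Mixed A V) : Prop := ∃ l t, Equivalent γ (linearSum l t)

theorem equivalent_lift_add_linearSum (t t' : RegularExpression A)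
    (l : List (RegularExpression A × V)) :
    Equivalent (lift t + linearSum l t') (linearSum l (t + t')) := by
  induction l with
  | nil => exact .refl _
  | cons p l ih => exact (Equivalent.add_left_comm _ _ _).e7 (.e6_right _ ih)

theorem Linearizable.add {γ δ : Mixed A V} (hγ : Linearizable γ) (hδ : Linearizable δ) :
    Linearizable (γ + δ) := by
  obtain ⟨l, t, h⟩ := hγ
  obtain ⟨l', t', h'⟩ := hδ
  refine ⟨l ++ l', t + t', (Equivalent.e6_left _ h).e7 ((Equivalent.e6_right _ h').e7 ?_)⟩
  clear h
  induction l with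
  | nil => exact equivalent_lift_add_linearSum t t' l'
  | cons p l ih => exact (Equivalent.e3 _ _ _).symm.e7 (.e6_right _ ih)

theorem linearizable_lift_mul_linearSum (s : RegularExpression A)
    (l : List (RegularExpression A × V)) (t : RegularExpression A) :
    Linearizable (lift s * linearSum l t) := by
  refine ⟨l.map fun p => (s * p.1, p.2), s * t, ?_⟩
  induction l with
  | nil => exact .refl _
  | cons p l ih =>
    exact (Equivalent.e1 _ _ _).e7
      ((Equivalent.e6_left _ (.e2 (lift s) (lift p.1) (var p.2))).e7 (.e6_right _ ih))

/-- The hypothesis concerns `s · α` rather than `α` because `≃` does not act inside products: the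
coefficient has to be distributed from outside. -/
theorem linearizable_subst {R : V} {α : Mixed A V} (hα : ∀ s, Linearizable (lift s * α))
    (l : List (RegularExpression A × V)) (t : RegularExpression A) :
    Linearizable (subst R α (linearSum l t)) := by
  induction l with
  | nil =>
    exact ⟨[], t, (subst_eq_self (α := α) (not_occurs_lift R t)).symm ▸ .refl _⟩
  | cons p l ih =>
    obtain ⟨s, S⟩ := p
    change Linearizable (subst R α (lift s) * subst R α (var S) + subst R α (linearSum l t))
    rw [subst_eq_self (not_occurs_lift R s)]
    by_cases hS : S = R
    · rw [show subst R α (var S) = α from if_pos hS]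
      exact (hα s).add ih
    · rw [show subst R α (var S) = var S from if_neg hS]
      obtain ⟨l', t', h⟩ := ih
      exact ⟨(s, S) :: l', t', .e6_right _ h⟩

/-- The equation `R ≈ γ` is in normal form with a linear sum as right-hand side. -/
def NormalLinear (R : V) (γ : Mixed A V) : Prop :=
  NormalForm R γ ∧ ∃ l t, γ = linearSum l t

theorem Linearizable.exists_normalLinear {γ : Mixed A V} (h : Linearizable γ) (R : V) :
    ∃ δ, Equivalent γ δ ∧ NormalLinear R δ := by
  obtain ⟨l, t, h⟩ := h
  obtain ⟨l', h', hn⟩ := exists_normal_linearSum R l t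
  exact ⟨_, h.e7 h', hn, l', t, rfl⟩

/-- A finite set of normal linear equations loses one of them by at most two solving steps. -/
theorem exists_steps {ψ E : Family A V} (hE : ∀ R γ, E R = some γ → NormalLinear R γ) {R : V}
    (hR : E R ≠ none) :
    ∃ ψ' E', Relation.ReflTransGen Step (ψ, E) (ψ', E') ∧
      (∀ S γ, E' S = some γ → NormalLinear S γ) ∧ E' R = none ∧
      ∀ S, E S = none → E' S = none := by
  classical
  -- `F` is either `E` itself or `E` after an Arden step at `R`; one (Subst) step then finishes.
  have key : ∀ (F : Family A V) (α : Mixed A V), F R = some α → ¬ Occurs R α →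
      (∀ s, Linearizable (lift s * α)) → (∀ S, S ≠ R → F S = E S) →
      Relation.ReflTransGen Step (ψ, E) (ψ, F) →
      ∃ ψ' E', Relation.ReflTransGen Step (ψ, E) (ψ', E') ∧
        (∀ S γ, E' S = some γ → NormalLinear S γ) ∧ E' R = none ∧
        ∀ S, E S = none → E' S = none := by
    intro F α hF hocc hα hFE hsteps
    have hex : ∀ S, ∃ o : Option (Mixed A V),
        Option.Rel Equivalent ((E S).map (subst R α)) o ∧
          (∀ γ, o = some γ → NormalLinear S γ) ∧ (E S = none → o = none) := by
      intro S
      cases hS : E S with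
      | none => exact ⟨none, .none, by simp, fun _ => rfl⟩
      | some γ =>
        obtain ⟨-, l, t, rfl⟩ := hE S γ hS
        obtain ⟨δ, hδ, hn⟩ := (linearizable_subst hα l t).exists_normalLinear S
        exact ⟨some δ, .some hδ, fun _ h => Option.some_inj.1 h ▸ hn, by simp⟩
    choose G hG₁ hG₂ hG₃ using hex
    refine ⟨_, Function.update G R none,
      hsteps.tail (.subst hF hocc (Function.update_self ..) fun S hS => ?_), ?_,
      Function.update_self .., ?_⟩
    · rw [Function.update_of_ne hS, hFE S hS]
      exact hG₁ S
    · intro S γ hS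
      by_cases hSR : S = R
      · subst hSR
        simp at hS
      · rw [Function.update_of_ne hSR] at hS
        exact hG₂ S γ hS
    · intro S hS
      by_cases hSR : S = R
      · subst hSR
        simp
      · rw [Function.update_of_ne hSR]
        exact hG₃ S hS
  obtain ⟨γ, hγ⟩ := Option.ne_none_iff_exists'.1 hR
  obtain ⟨⟨-, hocc | ⟨s, l, t, hnd, rfl⟩⟩, hlin⟩ := hE R γ hγ
  -- If `R` does not occur, the normal form says nothing about the nesting of the sum; linearity
  -- comes from the second half of `NormalLinear`.
  · obtain ⟨l, t, rfl⟩ := hlin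
    exact key E _ hγ hocc (fun s => linearizable_lift_mul_linearSum s l t) (fun _ _ => rfl) .refl
  · have hocc : ¬ Occurs R (linearSum l t) := fun h =>
      (List.nodup_cons.1 hnd).1 (occurs_linearSum.1 h)
    refine key _ (lift s.star * linearSum l t) (Function.update_self ..) ?_ (fun c => ?_)
      (fun S hS => Function.update_of_ne hS ..) (.single (.arden hγ hocc))
    · rintro (h | h)
      · exact not_occurs_lift R s.star h
      · exact hocc h
    -- The product `c · (s* · α)` is reassociated first, so that `c · s*` can be distributed over
    -- the linear sum.
    · obtain ⟨m, t', h⟩ := linearizable_lift_mul_linearSum (c * s.star) l t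
      exact ⟨m, t', (Equivalent.e2 (lift c) (lift s.star) (linearSum l t)).e7 h⟩

theorem exists_solution {ψ E : Family A V} (hfin : {R | E R ≠ none}.Finite)
    (hE : ∀ R γ, E R = some γ → NormalLinear R γ) :
    ∃ ψ', Relation.ReflTransGen Step (ψ, E) (ψ', emptyFamily A V) := by
  induction hn : {R | E R ≠ none}.ncard using Nat.strong_induction_on generalizing ψ E with
  | _ n ih =>
    subst hn
    by_cases hempty : ∃ R, E R ≠ none
    · obtain ⟨R, hR⟩ := hempty
      obtain ⟨ψ', E', hsteps, hE', hnone, hsub⟩ := exists_steps (ψ := ψ) hE hR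
      -- No equation is created and that of `R` is gone, so the number of equations drops.
      have hss : {S | E' S ≠ none} ⊂ {S | E S ≠ none} :=
        ⟨fun S hS h => hS (hsub S h), fun h => h hR hnone⟩
      obtain ⟨ψ'', h⟩ := ih _ (Set.ncard_lt_ncard hss hfin) (hfin.subset hss.1) hE' rfl
      exact ⟨ψ'', hsteps.trans h⟩
    · have : E = emptyFamily A V := funext fun R => by_contra fun h => hempty ⟨R, h⟩
      subst this
      exact ⟨ψ, .refl⟩

theorem exists_intersection_solution {A : Type u} [LinearOrder A] [Fintype A]
    (r s : RegularExpression A) :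
    ∃ E ψ : Family A (PairVar A),
      Rewrites (interEquations r s) E ∧ InNormalForm E ∧ SolvesTo E ψ := by
  have hex : ∀ p, ∃ o : Option (Mixed A (PairVar A)),
      Option.Rel Equivalent (interEquations r s p) o ∧ ∀ γ, o = some γ → NormalLinear p γ := by
    intro p
    cases hp : interEquations r s p with
    | none => exact ⟨none, .none, by simp⟩
    | some γ =>
      obtain ⟨rfl, -⟩ := interEquations_eq_some hp
      obtain ⟨l, t, h, -⟩ := interRhs_eq_linearSum p
      have hlin : Linearizable (interRhs p) := ⟨l, t, by rw [h]; exact .refl _⟩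
      obtain ⟨δ, hδ, hn⟩ := hlin.exists_normalLinear p
      exact ⟨some δ, .some hδ, fun _ h => Option.some_inj.1 h ▸ hn⟩
  choose E hE₁ hE₂ using hex
  have hfin : {p | E p ≠ none}.Finite := by
    refine ((finite_desc r).prod (finite_desc s)).subset fun p hp => ?_
    exact interEquations_ne_none.1 ((Rewrites.ne_none_iff hE₁ p).2 hp)
  obtain ⟨ψ, hψ⟩ := exists_solution (ψ := emptyFamily A _) hfin hE₂
  exact ⟨E, ψ, hE₁, fun p γ h => (hE₂ p γ h).1, hψ⟩

end Solvability

end RegEq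

theorem mainTheorem4 {A : Type*} [Fintype A] [LinearOrder A] (r s : RegularExpression A) :
    (∃ E ψ : RegEq.Family A (RegEq.PairVar A),
      RegEq.Rewrites (RegEq.interEquations r s) E ∧ RegEq.InNormalForm E ∧
        RegEq.SolvesTo E ψ) ∧
    ∀ E ψ : RegEq.Family A (RegEq.PairVar A),
      RegEq.Rewrites (RegEq.interEquations r s) E → RegEq.SolvesTo E ψ →
        ∃ e : RegularExpression A,
          ψ (RegEq.canon r, RegEq.canon s) = some (RegEq.lift e) ∧
          RegEq.Unambiguous e ∧
          e.matches' = r.matches' ⊓ s.matches' :=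
  ⟨RegEq.exists_intersection_solution r s, fun _ _ hE hψ => RegEq.intersection_correct hE hψ⟩
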